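/- Let $\mathbb F_4$ be the field with four elements, with conjugation $\overline a=a^2$, and for $u,v\in\mathbb F_4^n$ put $\langle u,v\rangle_H=\sum_{i=1}^n u_i\overline{v_i}$. A quaternary linear $[n,k,d]$ code is a $k$-dimensional subspace $C\subseteq\mathbb F_4^n$ whose nonzero words have minimum Hamming weight exactly $d$. Its Hermitian dual is $C^{\perp_H}=\{v\in\mathbb F_4^n : \langle u,v\rangle_H=0 \text{ for all } u\in C\}$ and its Hermitian hull is $\mathrm{Hull}_H(C)=C\cap C^{\perp_H}$. Let $D_4(n,k)$ be the largest $d$ for which a quaternary linear $[n,k,d]$ code exists, and let $D_4^H(n,k,1)$ be the largest $d$ for which a quaternary linear $[n,k,d]$ code $C$ with $\dim\mathrm{Hull}_H(C)=1$ exists. Then for all integers $1\le k<n\le 12$ the number $D_4^H(n,k,1)$ exists (that is, some $[n,k]$ code has one-dimensional Hermitian hull) and equals the entry in row $n$ and column $k$ of the following table: $$\begin{array}{c|ccccccccccc} n\backslash k&1&2&3&4&5&6&7&8&9&10&11\\\hline 2&2\\ 3&2&1\\ 4&4&3&2\\ 5&4&3&2&1\\ 6&6&4&3&2&2\\ 7&6&5&4&3&2&1\\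 8&8&5&5&4&3&2&2\\ 9&8&7&6&5&4&3&2&1\\ 10&10&7&6&5&5&4&3&2&2\\ 11&10&8&7&6&5&4&4&3&2&1\\ 12&12&9&8&7&6&6&4&4&3&2&2 \end{array}$$ Moreover, $D_4^H(n,k,1)<D_4(n,k)$ for $(n,k)\in\{(10,4),(11,5),(11,6)\}$. -/

import Mathlib

/-- The field with four elements. -/
abbrev F4 : Type := GaloisField 2 2

namespace Quaternary

/-- The Hermitian form `∑ uᵢ * conj vᵢ` on `F4ⁿ`, where the conjugate of `a` is `a ^ 2`. -/
noncomputable def hermInner {n : ℕ} (u v : Fin n → F4) : F4 :=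
  ∑ i, u i * v i ^ 2

/-- The Hermitian dual `{v | ⟨u, v⟩ = 0 for all u ∈ C}`. -/
noncomputable def hermDual {n : ℕ} (C : Submodule F4 (Fin n → F4)) :
    Submodule F4 (Fin n → F4) where
  carrier := {v | ∀ u ∈ C, hermInner u v = 0}
  zero_mem' := by
    intro u _
    simp [hermInner]
  add_mem' := by
    intro v w hv hw u hu
    have sq : ∀ a b : F4, (a + b) ^ 2 = a ^ 2 + b ^ 2 := fun a b => add_pow_char a b 2
    have h : hermInner u (v + w) = hermInner u v + hermInner u w := by
      simp only [hermInner, Pi.add_apply, sq, mul_add, Finset.sum_add_distrib]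
    rw [h, hv u hu, hw u hu, add_zero]
  smul_mem' := by
    intro a v hv u hu
    have h : hermInner u (a • v) = a ^ 2 * hermInner u v := by
      simp only [hermInner, Pi.smul_apply, smul_eq_mul, Finset.mul_sum]
      exact Finset.sum_congr rfl fun i _ => by ring
    rw [h, hv u hu, mul_zero]

/-- The Hermitian hull `C ∩ C^⊥`. -/
noncomputable def hermHull {n : ℕ} (C : Submodule F4 (Fin n → F4)) :
    Submodule F4 (Fin n → F4) :=
  C ⊓ hermDual C

open Classical in
/-- `C` is an `[n, k, d]` code: its dimension is `k` and `d` is the minimum Hamming weight of its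
nonzero words. -/
def IsCode (n k d : ℕ) (C : Submodule F4 (Fin n → F4)) : Prop :=
  Module.finrank F4 C = k ∧ IsLeast {w | ∃ c ∈ C, c ≠ 0 ∧ hammingNorm c = w} d

/-- `D = D₄(n, k)`: `D` is the largest `d` for which an `[n, k, d]` code exists. -/
def IsD4 (n k D : ℕ) : Prop :=
  IsGreatest {d | ∃ C : Submodule F4 (Fin n → F4), IsCode n k d C} D

/-- `D = D₄ᴴ(n, k, l)`: `D` is the largest `d` for which an `[n, k, d]` code with `l`-dimensional
Hermitian hull exists. -/
def IsD4H (n k l D : ℕ) : Prop :=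
  IsGreatest {d | ∃ C : Submodule F4 (Fin n → F4),
    IsCode n k d C ∧ Module.finrank F4 (hermHull C) = l} D

/-- Row `n` of the table of values `D₄ᴴ(n, k, 1)`, listed for `k = 1, …, n - 1`. -/
def tableRow : ℕ → List ℕ
  | 2 => [2]
  | 3 => [2, 1]
  | 4 => [4, 3, 2]
  | 5 => [4, 3, 2, 1]
  | 6 => [6, 4, 3, 2, 2]
  | 7 => [6, 5, 4, 3, 2, 1]
  | 8 => [8, 5, 5, 4, 3, 2, 2]
  | 9 => [8, 7, 6, 5, 4, 3, 2, 1]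
  | 10 => [10, 7, 6, 5, 5, 4, 3, 2, 2]
  | 11 => [10, 8, 7, 6, 5, 4, 4, 3, 2, 1]
  | 12 => [12, 9, 8, 7, 6, 6, 4, 4, 3, 2, 2]
  | _ => []

/-- The table entry in row `n` and column `k`, for `1 ≤ k < n ≤ 12`. -/
def tableEntry (n k : ℕ) : ℕ :=
  (tableRow n).getD (k - 1) 0

end Quaternary

/-!
The hull enters through the congruence `wt (u + v) ≡ wt u + wt v + tr ⟨u, v⟩` modulo 2. Squaring the
sum of `(-1) ^ wt c` over an `[n, k]` code with an `l`-dimensional hull determines this sum up to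
sign: it is `(-2) ^ (k + l)`. Together with the binomial moments, applied to the code and to its
shortenings at one coordinate, this excludes most of the parameters that survive the Plotkin bound,
shortening and duality. For odd `n`, a parity argument settles `k = 1` and `k = n - 1`; only
`[11, 5, 6]` and its dual partner `[11, 6, 5]` need more.

The hull of an `[11, 5, 6]` code would be spanned by a word `h` of weight six. Fix one of the five
zeros of `h`; each of the other four has a codeword that vanishes neither there nor at the fixed
zero, but at the remaining three. Restricted to the support of `h` and suitably scaled, these four
codewords and the zero word are five words of length six with inner products in the prime field.
Whenever the three inner products on a triple of these words sum to zero, their differences lie in a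
hexacode of one of two colours, and two such triples with two common elements have different
colours. A count shows that the number of these triples is even, whereas the nondegeneracy of two
Gram matrices, expressed by their Pfaffians, makes it odd.

Conversely, every table entry is attained by an explicit generator matrix, for which the
one-dimensional hull is seen from an orthogonal basis with a single isotropic vector.
-/

namespace Quaternary

section LinearCode

variable {K : Type*} [Field K] {n m k d : ℕ}
  {C : Submodule K (Fin n → K)} {S : Finset (Fin n)}

/-- All words of `C` vanish outside the coordinate set `S`. A code of length `m` is treated as a
code supported on `m` of its coordinates, so that shortening does not change the ambient space. -/
def SupportedOn (C : Submodule K (Fin n → K)) (S : Finset (Fin n)) : Prop :=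
  ∀ c ∈ C, ∀ i ∉ S, c i = 0

/-- The subcode of the words of `C` that vanish on `T`. -/
def shorten (C : Submodule K (Fin n → K)) (T : Finset (Fin n)) : Submodule K (Fin n → K) :=
  C ⊓ LinearMap.ker (LinearMap.funLeft K K ((↑) : T → Fin n))

lemma mem_shorten {T : Finset (Fin n)} {c : Fin n → K} :
    c ∈ shorten C T ↔ c ∈ C ∧ ∀ i ∈ T, c i = 0 := by
  simp [shorten, funext_iff]

lemma supportedOn_univ : SupportedOn C Finset.univ :=
  fun _ _ i hi => absurd (Finset.mem_univ i) hi

lemma SupportedOn.shorten (hS : SupportedOn C S) (T : Finset (Fin n)) :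
    SupportedOn (shorten C T) (S \ T) := by
  intro c hc i hi
  rw [mem_shorten] at hc
  by_cases h : i ∈ T
  · exact hc.2 i h
  · exact hS c hc.1 i fun h' => hi (Finset.mem_sdiff.2 ⟨h', h⟩)

lemma SupportedOn.mono {D : Submodule K (Fin n → K)} (hS : SupportedOn C S) (h : D ≤ C) :
    SupportedOn D S :=
  fun c hc => hS c (h hc)

lemma finrank_le_finrank_shorten_add_card (C : Submodule K (Fin n → K)) (T : Finset (Fin n)) :
    Module.finrank K C ≤ Module.finrank K (shorten C T) + T.card := by
  let f := (LinearMap.funLeft K K ((↑) : T → Fin n)).domRestrict C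
  have hker : Module.finrank K (LinearMap.ker f) = Module.finrank K (shorten C T) := by
    rw [LinearMap.ker_domRestrict, ← Submodule.finrank_map_subtype_eq, Submodule.map_comap_subtype,
      shorten]
  have hrange : Module.finrank K (LinearMap.range f) ≤ T.card := by
    simpa using Submodule.finrank_le (LinearMap.range f)
  have := LinearMap.finrank_range_add_finrank_ker f
  omega

lemma exists_le_finrank_eq (hk : k ≤ Module.finrank K C) : ∃ D ≤ C, Module.finrank K D = k := by
  obtain ⟨s, hs, hli⟩ := exists_finset_linearIndependent_of_le_finrank hk
  refine ⟨(Submodule.span K (s : Set C)).map C.subtype, Submodule.map_subtype_le _ _, ?_⟩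
  rw [Submodule.finrank_map_subtype_eq, finrank_span_finset_eq_card hli, hs]

variable [DecidableEq K]

/-- The minimum distance of `C` is at least `d`. -/
def MinDistGE (C : Submodule K (Fin n → K)) (d : ℕ) : Prop :=
  ∀ c ∈ C, c ≠ 0 → d ≤ hammingNorm c

variable (K) in
/-- No code of effective length `m`, dimension at least `k` and minimum distance at least `d`
exists over `K`. -/
def NoCode (m k d : ℕ) : Prop :=
  ∀ ⦃n : ℕ⦄ ⦃C : Submodule K (Fin n → K)⦄ ⦃S : Finset (Fin n)⦄, S.card = m → SupportedOn C S →
    MinDistGE C d → Module.finrank K C < k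

lemma MinDistGE.mono {D : Submodule K (Fin n → K)} (hd : MinDistGE C d) (h : D ≤ C) :
    MinDistGE D d :=
  fun c hc => hd c (h hc)

lemma MinDistGE.shorten (hd : MinDistGE C d) (T : Finset (Fin n)) :
    MinDistGE (shorten C T) d :=
  hd.mono inf_le_left

lemma NoCode.lengthen (h : NoCode K m k d) : NoCode K (m + 1) (k + 1) d := by
  intro n C S hS hC hd
  obtain ⟨i, hi⟩ : S.Nonempty := Finset.card_pos.1 (by omega)
  have hcard : (S \ {i}).card = m := by
    rw [Finset.sdiff_singleton_eq_erase, Finset.card_erase_of_mem hi, hS, Nat.add_sub_cancel]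
  have hlt := h hcard (hC.shorten {i}) (hd.shorten {i})
  have hle := finrank_le_finrank_shorten_add_card C {i}
  rw [Finset.card_singleton] at hle
  omega

lemma finrank_shorten_singleton (hS : SupportedOn C S) (hd : MinDistGE C d) {i : Fin n}
    (hi : i ∈ S) (hno : NoCode K (S.card - 1) (Module.finrank K C) d) :
    Module.finrank K (shorten C {i}) = Module.finrank K C - 1 := by
  have hlt := hno (Finset.card_sdiff_of_subset (Finset.singleton_subset_iff.2 hi))
    (hS.shorten {i}) (hd.shorten {i})
  have hle := finrank_le_finrank_shorten_add_card C {i}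
  rw [Finset.card_singleton] at hle
  omega

lemma card_filter_eq_zero_add_hammingNorm {c : Fin n → K} (hc : ∀ i ∉ S, c i = 0) :
    (S.filter fun i => c i = 0).card + hammingNorm c = S.card := by
  have hsupp : (S.filter fun i => ¬ c i = 0) = Finset.univ.filter fun i => c i ≠ 0 := by
    ext i
    have := hc i
    simp only [Finset.mem_filter, Finset.mem_univ, true_and]
    tauto
  rw [hammingNorm, ← hsupp]
  exact Finset.card_filter_add_card_filter_not _

lemma hammingNorm_le_card_of_support {c : Fin n → K} (hc : ∀ i ∉ S, c i = 0) :
    hammingNorm c ≤ S.card :=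
  (Nat.le_add_left _ _).trans_eq (card_filter_eq_zero_add_hammingNorm hc)

/-- Otherwise `T.erase i` and `T` would have the same shortening, of too large a dimension. -/
lemma exists_mem_eq_single (hS : SupportedOn C S) (hd : MinDistGE C d) {T : Finset (Fin n)}
    (hTS : T ⊆ S) (hTk : T.card ≤ Module.finrank K C)
    (hno : NoCode K (S.card - T.card) (Module.finrank K C - T.card + 1) d)
    {i : Fin n} (hi : i ∈ T) :
    ∃ c ∈ C, c i ≠ 0 ∧ ∀ j ∈ T, j ≠ i → c j = 0 := by
  by_contra! hcon
  have hle : shorten C (T.erase i) ≤ shorten C T := by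
    intro c hc
    rw [mem_shorten] at hc ⊢
    have hci : c i = 0 := by
      by_contra hne
      obtain ⟨j, hj, hji, hcj⟩ := hcon c hc.1 hne
      exact hcj (hc.2 j (Finset.mem_erase.2 ⟨hji, hj⟩))
    refine ⟨hc.1, fun j hj => ?_⟩
    obtain rfl | h := eq_or_ne j i
    · exact hci
    · exact hc.2 j (Finset.mem_erase.2 ⟨h, hj⟩)
  have hlt := hno (Finset.card_sdiff_of_subset hTS) (hS.shorten T) (hd.shorten T)
  have hmono := Submodule.finrank_mono hle
  have herase := finrank_le_finrank_shorten_add_card C (T.erase i)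
  have hpos := Finset.card_pos.2 ⟨i, hi⟩
  rw [Finset.card_erase_of_mem hi] at herase
  omega

end LinearCode

section WeightDistribution

variable {K : Type*} [Field K] [Finite K] {n m k d : ℕ}
  {C : Submodule K (Fin n → K)} {S : Finset (Fin n)}

/-- The words of `C` as a finite set. -/
noncomputable def words (C : Submodule K (Fin n → K)) : Finset (Fin n → K) :=
  (Set.toFinite (C : Set (Fin n → K))).toFinset

@[simp] lemma mem_words {c : Fin n → K} : c ∈ words C ↔ c ∈ C := by simp [words]

lemma card_words (C : Submodule K (Fin n → K)) :
    (words C).card = Nat.card K ^ Module.finrank K C := by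
  rw [← Module.natCard_eq_pow_finrank, words]
  exact (Nat.card_eq_card_finite_toFinset _).symm

variable [DecidableEq K]

/-- The number of words of weight `w` in `C`. -/
noncomputable def weightCount (C : Submodule K (Fin n → K)) (w : ℕ) : ℕ :=
  ((words C).filter fun c => hammingNorm c = w).card

lemma weightCount_zero (C : Submodule K (Fin n → K)) : weightCount C 0 = 1 := by
  rw [weightCount, Finset.card_eq_one]
  refine ⟨0, ?_⟩
  ext c
  simp +contextual [hammingNorm_eq_zero]

lemma MinDistGE.weightCount_eq_zero (hd : MinDistGE C d) {w : ℕ} (h0 : 0 < w) (hw : w < d) :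
    weightCount C w = 0 := by
  rw [weightCount, Finset.card_eq_zero, Finset.filter_eq_empty_iff]
  rintro c hc rfl
  exact (hd c (mem_words.1 hc) (hammingNorm_pos_iff.1 h0)).not_gt hw

/-- The units of `K` act freely on the words of weight `w`. -/
lemma card_sub_one_dvd_weightCount (C : Submodule K (Fin n → K)) {w : ℕ} (hw : w ≠ 0) :
    Nat.card K - 1 ∣ weightCount C w := by
  let X : SubMulAction Kˣ (Fin n → K) :=
    { carrier := {c | c ∈ C ∧ hammingNorm c = w}
      smul_mem' := fun a c hc => ⟨C.smul_mem (a : K) hc.1, by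
        rw [← hc.2, Units.smul_def, hammingNorm_smul]
        exact fun _ => a.isUnit.isSMulRegular K⟩ }
  have hfree (c : X) : MulAction.stabilizer Kˣ c = ⊥ := by
    have hc : (c : Fin n → K) ≠ 0 := by
      rw [← hammingNorm_ne_zero_iff, c.2.2]
      exact hw
    refine (Subgroup.eq_bot_iff_forall _).2 fun a ha => Units.ext ?_
    have hac : (a : K) • (c : Fin n → K) = c :=
      congrArg Subtype.val (MulAction.mem_stabilizer_iff.1 ha)
    exact smul_left_injective K hc (by simpa using hac)
  have hcard : weightCount C w = Nat.card X := by
    rw [weightCount, ← Nat.card_eq_finsetCard]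
    exact Nat.card_congr <| Equiv.subtypeEquivRight fun c => by
      rw [Finset.mem_filter, mem_words]
      rfl
  rw [hcard, Nat.card_congr (MulAction.selfEquivOrbitsQuotientProd hfree), Nat.card_prod,
    Nat.card_units]
  exact dvd_mul_left _ _

lemma SupportedOn.sum_words_eq_sum_weightCount (hS : SupportedOn C S) {R : Type*} [CommSemiring R]
    (f : ℕ → R) :
    ∑ c ∈ words C, f (hammingNorm c) =
      ∑ w ∈ Finset.range (S.card + 1), (weightCount C w : R) * f w := by
  have hmaps : ∀ c ∈ words C, hammingNorm c ∈ Finset.range (S.card + 1) := fun c hc =>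
    Finset.mem_range_succ_iff.2 (hammingNorm_le_card_of_support (hS c (mem_words.1 hc)))
  rw [← Finset.sum_fiberwise_of_maps_to hmaps]
  refine Finset.sum_congr rfl fun w _ => ?_
  rw [weightCount, ← nsmul_eq_mul, ← Finset.sum_const]
  exact Finset.sum_congr rfl fun c hc => by rw [(Finset.mem_filter.1 hc).2]

/-- Both sides count the pairs of a word and a `t`-set of its zeros in `S`. -/
lemma SupportedOn.sum_choose_eq_sum_card_shorten (hS : SupportedOn C S) (t : ℕ) :
    ∑ c ∈ words C, (S.card - hammingNorm c).choose t =
      ∑ T ∈ S.powersetCard t, (words (Quaternary.shorten C T)).card := by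
  have hzeros : ∀ c ∈ words C, (S.card - hammingNorm c).choose t =
      ((S.powersetCard t).filter fun T => ∀ i ∈ T, c i = 0).card := by
    intro c hc
    rw [← card_filter_eq_zero_add_hammingNorm (hS c (mem_words.1 hc)), Nat.add_sub_cancel,
      ← Finset.card_powersetCard]
    congr 1
    ext T
    simp only [Finset.mem_powersetCard, Finset.mem_filter, Finset.subset_iff]
    grind
  rw [Finset.sum_congr rfl hzeros]
  refine (Finset.sum_card_bipartiteAbove_eq_sum_card_bipartiteBelow
    (fun (c : Fin n → K) (T : Finset (Fin n)) => ∀ i ∈ T, c i = 0)).trans ?_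
  refine Finset.sum_congr rfl fun T _ => congrArg Finset.card ?_
  ext c
  simp [Finset.bipartiteBelow, mem_shorten]

/-- The bound on shorter codes forces all shortenings at `t` coordinates to have the generic
dimension. -/
lemma SupportedOn.sum_weightCount_mul_choose (hS : SupportedOn C S) (hd : MinDistGE C d) {t : ℕ}
    (ht : t ≤ Module.finrank K C)
    (hno : NoCode K (S.card - t) (Module.finrank K C - t + 1) d) :
    ∑ w ∈ Finset.range (S.card + 1), weightCount C w * (S.card - w).choose t =
      S.card.choose t * Nat.card K ^ (Module.finrank K C - t) := by
  have hgroup := hS.sum_words_eq_sum_weightCount fun w => (S.card - w).choose t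
  rw [hS.sum_choose_eq_sum_card_shorten t] at hgroup
  simp only [Nat.cast_id] at hgroup
  rw [← hgroup, ← Finset.card_powersetCard, ← smul_eq_mul]
  refine Finset.sum_eq_card_nsmul fun T hT => ?_
  obtain ⟨hTS, rfl⟩ := Finset.mem_powersetCard.1 hT
  have hlt := hno (Finset.card_sdiff_of_subset hTS) (hS.shorten T) (hd.shorten T)
  have hle := finrank_le_finrank_shorten_add_card C T
  rw [card_words]
  congr 1
  omega

lemma SupportedOn.sum_weightCount_shorten (hS : SupportedOn C S) (w : ℕ) :
    ∑ i ∈ S, weightCount (Quaternary.shorten C {i}) w = (S.card - w) * weightCount C w := by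
  have hfilter : ∀ i ∈ S, weightCount (Quaternary.shorten C {i}) w =
      (((words C).filter fun c => hammingNorm c = w).filter fun c => c i = 0).card := by
    intro i _
    rw [weightCount, Finset.filter_filter]
    congr 1
    ext c
    simp only [Finset.mem_filter, mem_words, mem_shorten, Finset.mem_singleton, forall_eq]
    tauto
  rw [Finset.sum_congr rfl hfilter]
  refine (Finset.sum_card_bipartiteAbove_eq_sum_card_bipartiteBelow
    (fun (i : Fin n) (c : Fin n → K) => c i = 0)).trans ?_
  rw [weightCount, mul_comm, ← smul_eq_mul]
  refine Finset.sum_eq_card_nsmul fun c hc => ?_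
  rw [Finset.mem_filter, mem_words] at hc
  rw [← hc.2, ← card_filter_eq_zero_add_hammingNorm (hS c hc.1), Nat.add_sub_cancel]
  rfl

lemma SupportedOn.sub_mul_weightCount (hS : SupportedOn C S) {h : Fin n → K}
    (hh : ∀ i ∉ S, h i = 0) {w a b : ℕ}
    (hcount : ∀ i ∈ S, weightCount (Quaternary.shorten C {i}) w = if h i = 0 then a else b) :
    (S.card - w) * weightCount C w = a * (S.card - hammingNorm h) + b * hammingNorm h := by
  have hcard := card_filter_eq_zero_add_hammingNorm hh
  have hsplit := Finset.card_filter_add_card_filter_not (s := S) (fun i => h i = 0)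
  rw [← hS.sum_weightCount_shorten, Finset.sum_congr rfl hcount, Finset.sum_ite, Finset.sum_const,
    Finset.sum_const, smul_eq_mul, smul_eq_mul, ← hcard, Nat.add_sub_cancel, mul_comm a,
    mul_comm b]
  congr 2
  omega

/-- The Plotkin bound: the words of a `k`-dimensional code have average weight at most
`m * (1 - 1 / q)`. -/
lemma NoCode.of_plotkin (hk : k ≠ 0)
    (h : m * Nat.card K ^ k < m * Nat.card K ^ (k - 1) + d * (Nat.card K ^ k - 1)) :
    NoCode K m k d := by
  rintro n C S rfl hS hd
  by_contra! hle
  obtain ⟨D, hDC, rfl⟩ := exists_le_finrank_eq hle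
  have hSD := hS.mono hDC
  set q := Nat.card K
  set r := Module.finrank K D
  have hzeros : S.card * q ^ (r - 1) ≤ ∑ c ∈ words D, (S.card - hammingNorm c) := by
    have hcount := hSD.sum_choose_eq_sum_card_shorten 1
    simp only [Nat.choose_one_right] at hcount
    rw [hcount, ← S.card.choose_one_right, ← Finset.card_powersetCard, ← smul_eq_mul]
    refine Finset.card_nsmul_le_sum _ _ _ fun T hT => ?_
    have hT := (finrank_le_finrank_shorten_add_card D T).trans_eq
      (congrArg _ (Finset.mem_powersetCard.1 hT).2)
    rw [card_words]
    exact Nat.pow_le_pow_right Nat.card_pos (by omega)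
  have hweights : d * (q ^ r - 1) ≤ ∑ c ∈ words D, hammingNorm c := by
    have hzero : (0 : Fin n → K) ∈ words D := mem_words.2 D.zero_mem
    rw [← Finset.add_sum_erase _ _ hzero, hammingNorm_zero, zero_add, ← card_words,
      ← Finset.card_erase_of_mem hzero, mul_comm, ← smul_eq_mul]
    refine Finset.card_nsmul_le_sum _ _ _ fun c hc => ?_
    exact (hd.mono hDC) c (mem_words.1 (Finset.mem_of_mem_erase hc)) (Finset.ne_of_mem_erase hc)
  have htotal : ∑ c ∈ words D, (S.card - hammingNorm c) + ∑ c ∈ words D, hammingNorm c =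
      S.card * q ^ r := by
    rw [← Finset.sum_add_distrib, ← card_words, mul_comm, ← smul_eq_mul]
    refine Finset.sum_eq_card_nsmul fun c hc => Nat.sub_add_cancel ?_
    exact hammingNorm_le_card_of_support (hSD c (mem_words.1 hc))
  omega

end WeightDistribution

section FieldOfFour

noncomputable instance : DecidableEq F4 := Classical.decEq F4

lemma natCard_F4 : Nat.card F4 = 4 := GaloisField.card 2 2 two_ne_zero

lemma pow_four_eq_self (x : F4) : x ^ 4 = x := by
  have := Fintype.ofFinite F4
  have h := FiniteField.pow_card x
  rwa [← Nat.card_eq_fintype_card, natCard_F4] at h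

lemma pow_three_eq_one {x : F4} (hx : x ≠ 0) : x ^ 3 = 1 :=
  mul_left_cancel₀ hx (by linear_combination pow_four_eq_self x)

lemma two_eq_zero : (2 : F4) = 0 := CharTwo.two_eq_zero

lemma add_sq_eq (a b : F4) : (a + b) ^ 2 = a ^ 2 + b ^ 2 := add_pow_char a b 2

lemma exists_sq_eq_add_one : ∃ x : F4, x ^ 2 = x + 1 := by
  obtain ⟨x, hx⟩ : ∃ x : F4, x ∉ ({0, 1} : Finset F4) := by
    by_contra! h
    have := Fintype.ofFinite F4
    have hcard := Finset.card_le_card fun x (_ : x ∈ Finset.univ) => h x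
    rw [Finset.card_univ, ← Nat.card_eq_fintype_card, natCard_F4] at hcard
    exact absurd (hcard.trans Finset.card_le_two) (by norm_num)
  rw [Finset.mem_insert, Finset.mem_singleton, not_or] at hx
  refine ⟨x, mul_left_cancel₀ (sub_ne_zero.2 hx.2) ?_⟩
  linear_combination pow_three_eq_one hx.1 - (x ^ 2 - 1) * two_eq_zero

/-- A primitive element of the field with four elements. -/
noncomputable def ω : F4 := exists_sq_eq_add_one.choose

lemma ω_sq : ω ^ 2 = ω + 1 := exists_sq_eq_add_one.choose_spec

lemma ω_ne_zero : ω ≠ 0 := by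
  intro h
  simpa [h] using ω_sq

lemma ω_add_one_ne_zero : ω + 1 ≠ 0 := by
  rw [← ω_sq]
  exact pow_ne_zero 2 ω_ne_zero

lemma eq_zero_or_one_or_ω (x : F4) : x = 0 ∨ x = 1 ∨ x = ω ∨ x = ω + 1 := by
  have h : x * ((x - 1) * ((x - ω) * (x - (ω + 1)))) = 0 := by
    linear_combination pow_four_eq_self x + (x ^ 2 - x) * ω_sq +
      (-(ω + 1) * x ^ 3 + (2 * ω + 1) * x ^ 2 - ω * x) * two_eq_zero
  simpa only [mul_eq_zero, sub_eq_zero] using h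

lemma natCast_F4_eq_zero_iff (w : ℕ) : (w : F4) = 0 ↔ Even w := by
  rw [CharP.cast_eq_zero_iff F4 2, even_iff_two_dvd]

end FieldOfFour

section HermitianForm

variable {n : ℕ}

lemma hermInner_zero_left (v : Fin n → F4) : hermInner 0 v = 0 := by
  simp [hermInner]

lemma hermInner_add_left (u v w : Fin n → F4) :
    hermInner (u + v) w = hermInner u w + hermInner v w := by
  simp [hermInner, add_mul, Finset.sum_add_distrib]

lemma hermInner_smul_left (a : F4) (u v : Fin n → F4) :
    hermInner (a • u) v = a * hermInner u v := by
  simp [hermInner, Finset.mul_sum, mul_assoc]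

lemma hermInner_comm (u v : Fin n → F4) : hermInner v u = hermInner u v ^ 2 := by
  rw [hermInner, hermInner, sum_pow_char]
  refine Finset.sum_congr rfl fun i _ => ?_
  rw [mul_pow, ← pow_mul, pow_four_eq_self, mul_comm]

lemma hermInner_comm_eq_zero {u v : Fin n → F4} (h : hermInner u v = 0) : hermInner v u = 0 := by
  rw [hermInner_comm, h, zero_pow two_ne_zero]

lemma hermInner_add_right (u v w : Fin n → F4) :
    hermInner u (v + w) = hermInner u v + hermInner u w := by
  rw [hermInner_comm _ u, hermInner_add_left, add_sq_eq, ← hermInner_comm, ← hermInner_comm]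

lemma hermInner_smul_right (a : F4) (u v : Fin n → F4) :
    hermInner u (a • v) = a ^ 2 * hermInner u v := by
  rw [hermInner_comm, hermInner_smul_left, mul_pow, ← hermInner_comm]

lemma hermInner_smul_add_smul_self {u v : Fin n → F4} (hu : hermInner u u = 0)
    (hv : hermInner v v = 0) (huv : hermInner u v = 0) (a b : F4) :
    hermInner (a • u + b • v) (a • u + b • v) = 0 := by
  simp only [hermInner_add_left, hermInner_add_right, hermInner_smul_left, hermInner_smul_right,
    hu, hv, huv, hermInner_comm_eq_zero huv, mul_zero, add_zero]

lemma hermInner_single_right (u : Fin n → F4) (i : Fin n) (a : F4) :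
    hermInner u (Pi.single i a) = u i * a ^ 2 := by
  simp [hermInner, Pi.single_apply]

lemma hermInner_self (c : Fin n → F4) : hermInner c c = (hammingNorm c : F4) := by
  rw [hammingNorm, Finset.natCast_card_filter, hermInner]
  refine Finset.sum_congr rfl fun i _ => ?_
  by_cases h : c i = 0
  · simp [h]
  · rw [if_pos h, ← pow_three_eq_one h, ← pow_succ']

end HermitianForm

section SignedCount

variable {n : ℕ} {C : Submodule F4 (Fin n → F4)}

/-- The absolute trace, as an element of the prime field inside `F4`. -/
noncomputable def tr (x : F4) : F4 := x + x ^ 2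

/-- The sign `(-1) ^ x` of an element `x` of the prime field inside `F4`. -/
noncomputable def sign (x : F4) : ℤ := if x = 0 then 1 else -1

lemma tr_add (x y : F4) : tr (x + y) = tr x + tr y := by
  rw [tr, tr, tr, add_sq_eq]
  ring

lemma tr_ω : tr ω = 1 := by
  rw [tr, ω_sq]
  linear_combination ω * two_eq_zero

lemma isIdempotentElem_tr (x : F4) : IsIdempotentElem (tr x) := by
  rw [IsIdempotentElem, tr]
  linear_combination pow_four_eq_self x + x ^ 3 * two_eq_zero

lemma isIdempotentElem_natCast (w : ℕ) : IsIdempotentElem (w : F4) := by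
  rw [IsIdempotentElem, ← sub_eq_zero, ← mul_sub_one]
  obtain h | h := Nat.even_or_odd w
  · rw [(natCast_F4_eq_zero_iff w).2 h, zero_mul]
  · obtain ⟨j, rfl⟩ := h
    push_cast
    linear_combination (2 * j + 1 : F4) * j * two_eq_zero

lemma sign_add {x y : F4} (hx : IsIdempotentElem x) (hy : IsIdempotentElem y) :
    sign (x + y) = sign x * sign y := by
  obtain rfl | rfl := IsIdempotentElem.iff_eq_zero_or_one.1 hx <;>
    obtain rfl | rfl := IsIdempotentElem.iff_eq_zero_or_one.1 hy <;>
    simp [sign, one_add_one_eq_two, two_eq_zero]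

lemma neg_one_pow_eq_sign (w : ℕ) : (-1 : ℤ) ^ w = sign w := by
  rw [sign]
  split_ifs with h
  · exact ((natCast_F4_eq_zero_iff w).1 h).neg_one_pow
  · rw [natCast_F4_eq_zero_iff, Nat.not_even_iff_odd] at h
    exact h.neg_one_pow

lemma natCast_hammingNorm_add (u v : Fin n → F4) :
    (hammingNorm (u + v) : F4) = hammingNorm u + hammingNorm v + tr (hermInner u v) := by
  simp only [← hermInner_self, hermInner_add_left, hermInner_add_right, hermInner_comm u v, tr]
  ring

lemma neg_one_pow_hammingNorm_add (c e : Fin n → F4) :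
    (-1 : ℤ) ^ hammingNorm (c + e) =
      (-1) ^ hammingNorm c * (-1) ^ hammingNorm e * sign (tr (hermInner c e)) := by
  rw [← pow_add, neg_one_pow_eq_sign, neg_one_pow_eq_sign,
    natCast_hammingNorm_add, ← Nat.cast_add,
    sign_add (isIdempotentElem_natCast _) (isIdempotentElem_tr _)]

/-- The number of words of even weight minus the number of words of odd weight. -/
noncomputable def signedCount (C : Submodule F4 (Fin n → F4)) : ℤ :=
  ∑ c ∈ words C, (-1) ^ hammingNorm c

lemma sum_words_add {c : Fin n → F4} (hc : c ∈ C) (f : (Fin n → F4) → ℤ) :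
    ∑ e ∈ words C, f (c + e) = ∑ e ∈ words C, f e :=
  Finset.sum_nbij' (c + ·) (· - c)
    (fun _ he => mem_words.2 (C.add_mem hc (mem_words.1 he)))
    (fun _ he => mem_words.2 (C.sub_mem (mem_words.1 he) hc))
    (fun e _ => add_sub_cancel_left c e) (fun e _ => add_sub_cancel c e) fun _ _ => rfl

/-- Orthogonality of the characters `c ↦ (-1) ^ tr ⟨c, e⟩` of `C`. -/
lemma sum_sign_tr_hermInner (C : Submodule F4 (Fin n → F4)) (e : Fin n → F4)
    [Decidable (e ∈ hermDual C)] :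
    ∑ c ∈ words C, sign (tr (hermInner c e)) =
      if e ∈ hermDual C then ((words C).card : ℤ) else 0 := by
  split_ifs with h
  · rw [← nsmul_one, ← Finset.sum_const]
    refine Finset.sum_congr rfl fun c hc => ?_
    rw [h c (mem_words.1 hc)]
    simp [tr, sign]
  · obtain ⟨u, hu, hne⟩ : ∃ u ∈ C, hermInner u e ≠ 0 := by
      by_contra! h'
      exact h h'
    have hu1 : tr (hermInner ((ω * (hermInner u e)⁻¹) • u) e) = 1 := by
      rw [hermInner_smul_left, mul_assoc, inv_mul_cancel₀ hne, mul_one, tr_ω]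
    have htranslate := sum_words_add (C.smul_mem (ω * (hermInner u e)⁻¹) hu)
      fun c => sign (tr (hermInner c e))
    have hflip (c : Fin n → F4) :
        sign (1 + tr (hermInner c e)) = -sign (tr (hermInner c e)) := by
      rw [sign_add .one (isIdempotentElem_tr _), sign, if_neg one_ne_zero, neg_one_mul]
    simp only [hermInner_add_left, tr_add, hu1, hflip, Finset.sum_neg_distrib] at htranslate
    linarith

lemma even_hammingNorm_of_mem_hermHull {c : Fin n → F4} (hc : c ∈ hermHull C) :
    Even (hammingNorm c) := by
  rw [← natCast_F4_eq_zero_iff, ← hermInner_self]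
  exact hc.2 c hc.1

/-- Expanding the square and translating by a word turns it into a sum of `(-1) ^ wt e` times the
character sum of `e`, in which only the words `e` of the hull survive. -/
lemma signedCount_sq (C : Submodule F4 (Fin n → F4)) :
    signedCount C ^ 2 = 4 ^ (Module.finrank F4 C + Module.finrank F4 (hermHull C)) := by
  classical
  have hexpand : signedCount C ^ 2 =
      ∑ e ∈ words C, (-1) ^ hammingNorm e * ∑ c ∈ words C, sign (tr (hermInner c e)) := by
    simp only [Finset.mul_sum]
    rw [Finset.sum_comm, sq]
    nth_rewrite 1 [signedCount]
    rw [Finset.sum_mul]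
    refine Finset.sum_congr rfl fun c hc => ?_
    rw [signedCount, ← sum_words_add (mem_words.1 hc), Finset.mul_sum]
    refine Finset.sum_congr rfl fun e _ => ?_
    rw [neg_one_pow_hammingNorm_add, ← mul_assoc, ← mul_assoc, ← mul_pow]
    norm_num
  have hhull : (words C).filter (· ∈ hermDual C) = words (hermHull C) := by
    ext c
    simp [hermHull]
  simp only [hexpand, sum_sign_tr_hermInner, mul_ite, mul_zero]
  rw [← Finset.sum_filter, hhull, Finset.sum_congr rfl (g := fun _ => ((words C).card : ℤ))
    fun c hc => by rw [(even_hammingNorm_of_mem_hermHull (mem_words.1 hc)).neg_one_pow, one_mul],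
    Finset.sum_const, card_words, card_words, natCard_F4, nsmul_eq_mul]
  push_cast
  ring

lemma three_dvd_weightCount (C : Submodule F4 (Fin n → F4)) {w : ℕ} (hw : w ≠ 0) :
    3 ∣ weightCount C w := by
  simpa [natCard_F4] using card_sub_one_dvd_weightCount C hw

lemma SupportedOn.sum_weightCount_mul_neg_one_pow {S : Finset (Fin n)} (hS : SupportedOn C S) :
    ∑ w ∈ Finset.range (S.card + 1), (weightCount C w : ℤ) * (-1) ^ w = signedCount C :=
  (hS.sum_words_eq_sum_weightCount fun w => (-1 : ℤ) ^ w).symm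

lemma three_dvd_signedCount_sub_one (C : Submodule F4 (Fin n → F4)) :
    (3 : ℤ) ∣ signedCount C - 1 := by
  rw [← supportedOn_univ.sum_weightCount_mul_neg_one_pow, Finset.sum_range_succ', weightCount_zero]
  simp only [Nat.cast_one, pow_zero, mul_one, add_sub_cancel_right]
  refine Finset.dvd_sum fun w _ => Dvd.dvd.mul_right ?_ _
  exact_mod_cast three_dvd_weightCount C w.succ_ne_zero

/-- The square of both sides agrees; divisibility by three fixes the sign. -/
lemma signedCount_eq (C : Submodule F4 (Fin n → F4)) :
    signedCount C = (-2) ^ (Module.finrank F4 C + Module.finrank F4 (hermHull C)) := by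
  set j := Module.finrank F4 C + Module.finrank F4 (hermHull C) with hj
  have hsq : signedCount C ^ 2 = ((-2) ^ j) ^ 2 := by
    rw [signedCount_sq, ← hj, ← pow_mul, mul_comm, pow_mul]
    norm_num
  obtain h | h := sq_eq_sq_iff_eq_or_eq_neg.1 hsq
  · exact h
  · have hcount := three_dvd_signedCount_sub_one C
    have hpow : (3 : ℤ) ∣ (-2) ^ j - 1 := by
      simpa using (by norm_num : (3 : ℤ) ∣ -2 - 1).trans (sub_dvd_pow_sub_pow (-2 : ℤ) 1 j)
    rw [h] at hcount
    omega

end SignedCount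

section HermitianDual

variable {n : ℕ} {C : Submodule F4 (Fin n → F4)}

lemma mem_hermDual_span {s : Set (Fin n → F4)} {v : Fin n → F4} :
    v ∈ hermDual (Submodule.span F4 s) ↔ ∀ x ∈ s, hermInner x v = 0 := by
  refine ⟨fun hv x hx => hv x (Submodule.subset_span hx), fun hv x hx => ?_⟩
  induction hx using Submodule.span_induction with
  | mem x hx => exact hv x hx
  | zero => simp [hermInner]
  | add x y _ _ hx hy => rw [hermInner_add_left, hx, hy, add_zero]
  | smul a x _ hx => rw [hermInner_smul_left, hx, mul_zero]

lemma hermDual_top : hermDual (⊤ : Submodule F4 (Fin n → F4)) = ⊥ := by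
  refine (Submodule.eq_bot_iff _).2 fun v hv => funext fun i => ?_
  have hi := hermInner_comm_eq_zero (hv (Pi.single i 1) trivial)
  rwa [hermInner_single_right, one_pow, mul_one] at hi

/-- Sum the orthogonality relations of the characters of `C` over the whole space. -/
lemma finrank_hermDual_add_finrank (C : Submodule F4 (Fin n → F4)) :
    Module.finrank F4 (hermDual C) + Module.finrank F4 C = n := by
  classical
  have hswap (c e : Fin n → F4) : tr (hermInner c e) = tr (hermInner e c) := by
    rw [hermInner_comm e c, tr, tr, ← pow_mul, pow_four_eq_self, add_comm]
  have hdual : (words ⊤).filter (· ∈ hermDual C) = words (hermDual C) := by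
    ext c
    simp
  have hzero : (words C).filter (· ∈ hermDual (⊤ : Submodule F4 (Fin n → F4))) = {0} := by
    ext c
    simp +contextual [hermDual_top]
  have hsum : ∑ e ∈ words (⊤ : Submodule F4 (Fin n → F4)), ∑ c ∈ words C,
      sign (tr (hermInner c e)) = ∑ c ∈ words C, ∑ e ∈ words (⊤ : Submodule F4 (Fin n → F4)),
        sign (tr (hermInner e c)) := by
    rw [Finset.sum_comm]
    simp only [hswap]
  simp only [sum_sign_tr_hermInner] at hsum
  rw [← Finset.sum_filter, ← Finset.sum_filter, hdual, hzero, Finset.sum_const,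
    Finset.sum_singleton, card_words, card_words, card_words, natCard_F4, finrank_top,
    Module.finrank_fin_fun, nsmul_eq_mul, ← Nat.cast_mul, Nat.cast_inj, ← pow_add] at hsum
  exact Nat.pow_right_injective (by norm_num) hsum

lemma hermDual_hermDual (C : Submodule F4 (Fin n → F4)) : hermDual (hermDual C) = C := by
  have hle : C ≤ hermDual (hermDual C) := fun c hc v hv => hermInner_comm_eq_zero (hv c hc)
  refine (Submodule.eq_of_le_of_finrank_eq hle ?_).symm
  have hC := finrank_hermDual_add_finrank C
  have hD := finrank_hermDual_add_finrank (hermDual C)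
  omega

lemma hermHull_hermDual (C : Submodule F4 (Fin n → F4)) : hermHull (hermDual C) = hermHull C := by
  rw [hermHull, hermHull, hermDual_hermDual, inf_comm]

/-- A short dual word would be a linear dependence between few coordinates of `C`. -/
lemma MinDistGE.shorten_hermDual {S : Finset (Fin n)} {d e : ℕ} (hd : MinDistGE C d)
    (hS : SupportedOn C S) (he : e ≤ Module.finrank F4 C)
    (hno : ∀ t ≤ e, NoCode F4 (S.card - t) (Module.finrank F4 C - t + 1) d) :
    MinDistGE (Quaternary.shorten (hermDual C) Sᶜ) (e + 1) := by
  intro v hv hv0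
  rw [mem_shorten] at hv
  by_contra! hlt
  obtain ⟨i, hi⟩ := Function.ne_iff.1 hv0
  have hcard : (Finset.univ.filter fun i => v i ≠ 0).card = hammingNorm v := rfl
  have hsupp : (Finset.univ.filter fun i => v i ≠ 0) ⊆ S := fun j hj => by
    by_contra h
    exact (Finset.mem_filter.1 hj).2 (hv.2 j (Finset.mem_compl.2 h))
  obtain ⟨c, hc, hci, hcj⟩ := exists_mem_eq_single hS hd hsupp (by omega) (hno _ (by omega))
    (Finset.mem_filter.2 ⟨Finset.mem_univ i, hi⟩)
  have hsum := hv.1 c hc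
  rw [hermInner, Finset.sum_eq_single i] at hsum
  · exact mul_ne_zero hci (pow_ne_zero 2 hi) hsum
  · intro j _ hj
    by_cases h : v j = 0
    · rw [h, zero_pow two_ne_zero, mul_zero]
    · rw [hcj j (Finset.mem_filter.2 ⟨Finset.mem_univ j, h⟩) hj, zero_mul]
  · exact fun h => absurd (Finset.mem_univ i) h

lemma NoCode.of_hermDual {m k d e : ℕ} (hdual : NoCode F4 m (m - k) (e + 1)) (hk : k ≤ m)
    (hek : e ≤ k) (hno : ∀ t ≤ e, NoCode F4 (m - t) (k - t + 1) d) : NoCode F4 m k d := by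
  rintro n C S rfl hS hd
  by_contra! hle
  obtain ⟨D, hDC, rfl⟩ := exists_le_finrank_eq hle
  have hlt := hdual rfl (fun v hv i hi => (mem_shorten.1 hv).2 i (Finset.mem_compl.2 hi))
    ((hd.mono hDC).shorten_hermDual (hS.mono hDC) hek hno)
  have hshort := finrank_le_finrank_shorten_add_card (hermDual D) Sᶜ
  have hsum := finrank_hermDual_add_finrank D
  have hcompl := S.card_compl_add_card
  rw [Fintype.card_fin] at hcompl
  omega

end HermitianDual

section Bounds

variable {n m k d : ℕ} {C : Submodule F4 (Fin n → F4)} {S : Finset (Fin n)}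

/-- The conditions on a sequence `A` that hold for the weight distribution of an `[m, k]` code of
minimum distance at least `d`. -/
structure WeightConstraints (m k d : ℕ) (A : ℕ → ℕ) : Prop where
  zero : A 0 = 1
  eq_zero : ∀ w, 0 < w → w < d → A w = 0
  three_dvd : ∀ w, w ≠ 0 → 3 ∣ A w
  moment : ∀ t ≤ k, NoCode F4 (m - t) (k - t + 1) d →
    ∑ w ∈ Finset.range (m + 1), A w * (m - w).choose t = m.choose t * 4 ^ (k - t)

lemma MinDistGE.weightConstraints (hd : MinDistGE C d) (hS : SupportedOn C S) :
    WeightConstraints S.card (Module.finrank F4 C) d (weightCount C) where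
  zero := weightCount_zero C
  eq_zero _ h0 hw := hd.weightCount_eq_zero h0 hw
  three_dvd _ hw := three_dvd_weightCount C hw
  moment _ ht hno := by rw [hS.sum_weightCount_mul_choose hd ht hno, natCard_F4]

lemma NoCode.of_forall_not_weightConstraints (h : ∀ A, ¬ WeightConstraints m k d A) :
    NoCode F4 m k d := by
  rintro n C S rfl hS hd
  by_contra! hle
  obtain ⟨D, hDC, rfl⟩ := exists_le_finrank_eq hle
  exact h _ ((hd.mono hDC).weightConstraints (hS.mono hDC))

/-- Parameters excluded by the Plotkin bound and shortening, starting from a list of parameters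
already known to be excluded. -/
def excluded (B : List (ℕ × ℕ × ℕ)) : ℕ → ℕ → ℕ → Bool
  | _, 0, _ => false
  | m, k + 1, d => decide (m * 4 ^ (k + 1) < m * 4 ^ k + d * (4 ^ (k + 1) - 1)) ||
      decide ((m, k + 1, d) ∈ B) || (decide (1 ≤ m) && excluded B (m - 1) k d)

lemma NoCode.of_excluded {B : List (ℕ × ℕ × ℕ)} (hB : ∀ b ∈ B, NoCode F4 b.1 b.2.1 b.2.2)
    (h : excluded B m k d = true) : NoCode F4 m k d := by
  induction k generalizing m with
  | zero => simp [excluded] at h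
  | succ k ih =>
    simp only [excluded, Bool.or_eq_true, Bool.and_eq_true, decide_eq_true_eq] at h
    obtain (hplotkin | hmem) | ⟨hm, hshort⟩ := h
    · exact NoCode.of_plotkin k.succ_ne_zero (by rwa [natCard_F4, Nat.succ_sub_one])
    · exact hB _ hmem
    · obtain ⟨m, rfl⟩ := Nat.exists_eq_add_of_le' hm
      exact (ih hshort).lengthen

lemma NoCode.of_excluded_nil (h : excluded [] m k d = true) : NoCode F4 m k d :=
  .of_excluded (fun _ hb => absurd hb List.not_mem_nil) h

lemma noCode_11_3_8 : NoCode F4 11 3 8 := by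
  refine .of_forall_not_weightConstraints fun A hA => ?_
  have e1 := hA.moment 1 (by norm_num) (.of_excluded_nil (by decide))
  have e2 := hA.moment 2 (by norm_num) (.of_excluded_nil (by decide))
  have h8 := hA.three_dvd 8 (by norm_num)
  simp [Finset.sum_range_succ, hA.zero, hA.eq_zero, Nat.choose] at e1 e2
  omega

lemma WeightConstraints.nine_eq_zero {A : ℕ → ℕ} (hA : WeightConstraints 9 2 7 A) : A 9 = 0 := by
  have e0 := hA.moment 0 (by norm_num) (.of_excluded_nil (by decide))
  have e1 := hA.moment 1 (by norm_num) (.of_excluded_nil (by decide))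
  have h9 := hA.three_dvd 9 (by norm_num)
  simp [Finset.sum_range_succ, hA.zero, hA.eq_zero, Nat.choose] at e0 e1
  omega

lemma WeightConstraints.nine_ne_zero {A : ℕ → ℕ} (hA : WeightConstraints 10 3 7 A) : A 9 ≠ 0 := by
  intro h9
  have e0 := hA.moment 0 (by norm_num) (.of_excluded_nil (by decide))
  have e1 := hA.moment 1 (by norm_num) (.of_excluded_nil (by decide))
  have e2 := hA.moment 2 (by norm_num) (.of_excluded_nil (by decide))
  have h7 := hA.three_dvd 7 (by norm_num)
  simp [Finset.sum_range_succ, hA.zero, hA.eq_zero, Nat.choose, h9] at e0 e1 e2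
  omega

lemma noCode_10_3_7 : NoCode F4 10 3 7 := by
  intro n C S hS hC hd
  by_contra! hle
  obtain ⟨D, hDC, hD⟩ := exists_le_finrank_eq hle
  replace hC := hC.mono hDC
  replace hd := hd.mono hDC
  have hshort : ∀ i ∈ S, weightCount (shorten D {i}) 9 = 0 := by
    intro i hi
    have hcard : (S \ {i}).card = 9 := by
      rw [Finset.card_sdiff_of_subset (Finset.singleton_subset_iff.2 hi), hS,
        Finset.card_singleton]
    have hdim := finrank_shorten_singleton hC hd hi
      (.of_excluded_nil (by rw [hS, hD]; decide))
    have hA := (hd.shorten {i}).weightConstraints (hC.shorten {i})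
    rw [hcard, hdim, hD] at hA
    exact hA.nine_eq_zero
  have hA := hd.weightConstraints hC
  rw [hS, hD] at hA
  have hsum := hC.sum_weightCount_shorten 9
  rw [Finset.sum_eq_zero hshort, hS] at hsum
  exact hA.nine_ne_zero (by omega)

lemma noCode_6_4_3 : NoCode F4 6 4 3 :=
  .of_hermDual (e := 4) (.of_excluded_nil (by decide)) (by norm_num) le_rfl
    fun t ht => .of_excluded_nil (by interval_cases t <;> decide)

lemma noCode_7_4_4 : NoCode F4 7 4 4 :=
  .of_hermDual (e := 4) (.of_excluded_nil (by decide)) (by norm_num) le_rfl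
    fun t ht => .of_excluded_nil (by interval_cases t <;> decide)

lemma noCode_12_7_5 : NoCode F4 12 7 5 :=
  .of_hermDual (e := 6)
    (.of_excluded (B := [(10, 3, 7)]) (by simpa using noCode_10_3_7) (by decide))
    (by norm_num) (by norm_num) fun t ht => .of_excluded_nil (by interval_cases t <;> decide)

/-- Excluded parameters that do not follow from the Plotkin bound by shortening. -/
def sporadic : List (ℕ × ℕ × ℕ) := [(11, 3, 8), (10, 3, 7), (6, 4, 3), (7, 4, 4), (12, 7, 5)]

lemma NoCode.of_excluded_sporadic (h : excluded sporadic m k d = true) : NoCode F4 m k d :=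
  .of_excluded (B := sporadic) (by
    simpa [sporadic] using
      ⟨noCode_11_3_8, noCode_10_3_7, noCode_6_4_3, noCode_7_4_4, noCode_12_7_5⟩) h

end Bounds

section OneDimensionalHull

variable {n d : ℕ} {C : Submodule F4 (Fin n → F4)} {S : Finset (Fin n)}

lemma exists_hermHull_eq_span (hl : Module.finrank F4 (hermHull C) = 1) :
    ∃ h, h ≠ 0 ∧ hermHull C = Submodule.span F4 {h} := by
  obtain ⟨h, hh⟩ := ((hermHull C).finrank_le_one_iff_isPrincipal.1 hl.le).principal
  refine ⟨h, ?_, hh⟩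
  rintro rfl
  rw [hh, Submodule.span_singleton_eq_bot.2 rfl, finrank_bot] at hl
  exact zero_ne_one hl

lemma finrank_hermHull_ne_one_of_odd_of_minDistGE (hn : Odd n) (hd : MinDistGE C n) :
    Module.finrank F4 (hermHull C) ≠ 1 := by
  intro hl
  obtain ⟨h, h0, hh⟩ := exists_hermHull_eq_span hl
  have hmem : h ∈ hermHull C := hh ▸ Submodule.mem_span_singleton_self h
  have hle : hammingNorm h ≤ n := by simpa using hammingNorm_le_card_fintype (x := h)
  have heven := even_hammingNorm_of_mem_hermHull hmem
  rw [le_antisymm hle (hd h hmem.1 h0)] at heven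
  exact Nat.not_even_iff_odd.2 hn heven

/-- The dual is spanned by a word of even weight, so it vanishes at some coordinate, and `C`
contains the corresponding unit vector. -/
lemma finrank_hermHull_ne_one_of_finrank_add_one_eq (hn : Odd n)
    (hk : Module.finrank F4 C + 1 = n) (hd : MinDistGE C 2) :
    Module.finrank F4 (hermHull C) ≠ 1 := by
  intro hl
  have hhull : hermHull C = hermDual C := by
    have := finrank_hermDual_add_finrank C
    exact Submodule.eq_of_le_of_finrank_eq inf_le_right (by omega)
  obtain ⟨h, -, hh⟩ := exists_hermHull_eq_span hl
  have hmem : h ∈ hermHull C := hh ▸ Submodule.mem_span_singleton_self h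
  obtain ⟨i, hi⟩ : ∃ i, h i = 0 := by
    by_contra! hne
    have heven := even_hammingNorm_of_mem_hermHull hmem
    rw [hammingNorm, Finset.filter_true_of_mem fun i _ => hne i, Finset.card_univ,
      Fintype.card_fin] at heven
    exact Nat.not_even_iff_odd.2 hn heven
  have hsingle : Pi.single i 1 ∈ C := by
    rw [← hermDual_hermDual C, ← hhull, hh]
    intro v hv
    obtain ⟨a, rfl⟩ := Submodule.mem_span_singleton.1 hv
    rw [hermInner_single_right, Pi.smul_apply, hi, smul_zero, zero_mul]
  have hweight := hd _ hsingle (by simp)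
  have hone : hammingNorm (Pi.single i 1 : Fin n → F4) ≤ 1 := by
    refine Finset.card_le_one.2 fun a ha b hb => ?_
    rw [Finset.mem_filter, Pi.single_apply, ne_eq, ite_eq_right_iff, Classical.not_imp] at ha hb
    rw [ha.2.1, hb.2.1]
  omega

lemma mem_hermHull_of_mem_hermHull_shorten {i : Fin n} {u v : Fin n → F4} (hu : u ∈ C)
    (hui : u i ≠ 0) (hv : v ∈ hermHull (shorten C {i})) (huv : hermInner u v = 0) :
    v ∈ hermHull C := by
  refine ⟨(mem_shorten.1 hv.1).1, fun w hw => ?_⟩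
  have hsub : w + (-(w i / u i)) • u ∈ shorten C {i} := by
    refine mem_shorten.2 ⟨C.add_mem hw (C.smul_mem _ hu), fun j hj => ?_⟩
    rw [Finset.mem_singleton.1 hj]
    simp [div_mul_cancel₀ _ hui]
  have horth := hv.2 _ hsub
  rwa [hermInner_add_left, hermInner_smul_left, huv, mul_zero, add_zero] at horth

lemma hermHull_shorten_singleton_eq_bot {h : Fin n → F4}
    (hh : hermHull C = Submodule.span F4 {h}) {i : Fin n} (hi : h i ≠ 0) :
    hermHull (shorten C {i}) = ⊥ := by
  have hmem : h ∈ hermHull C := hh ▸ Submodule.mem_span_singleton_self h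
  refine (Submodule.eq_bot_iff _).2 fun v hv => ?_
  have hvC := mem_hermHull_of_mem_hermHull_shorten hmem.1 hi hv
    (hermInner_comm_eq_zero (hmem.2 v (mem_shorten.1 hv.1).1))
  rw [hh, Submodule.mem_span_singleton] at hvC
  obtain ⟨a, rfl⟩ := hvC
  have hzero := (mem_shorten.1 hv.1).2 i (Finset.mem_singleton_self i)
  rw [Pi.smul_apply, smul_eq_mul, mul_eq_zero, or_iff_left hi] at hzero
  rw [hzero, zero_smul]

lemma hermHull_shorten_singleton_ne_bot {h : Fin n → F4} (hmem : h ∈ hermHull C) (h0 : h ≠ 0)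
    {i : Fin n} (hi : h i = 0) : hermHull (shorten C {i}) ≠ ⊥ := by
  refine (Submodule.ne_bot_iff _).2 ⟨h, ⟨mem_shorten.2 ⟨hmem.1, by simpa using hi⟩, ?_⟩, h0⟩
  exact fun u hu => hmem.2 u (mem_shorten.1 hu).1

lemma finrank_hermHull_shorten_singleton_le (C : Submodule F4 (Fin n → F4)) (i : Fin n) :
    Module.finrank F4 (hermHull (shorten C {i})) ≤ Module.finrank F4 (hermHull C) + 1 := by
  by_cases hzero : ∀ c ∈ C, c i = 0
  · have hC : shorten C {i} = C :=
      le_antisymm inf_le_left fun c hc => mem_shorten.2 ⟨hc, by simpa using hzero c hc⟩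
    rw [hC]
    exact Nat.le_succ _
  · push Not at hzero
    obtain ⟨u, hu, hui⟩ := hzero
    let f : hermHull (shorten C {i}) →ₗ[F4] F4 :=
      { toFun := fun v => hermInner v.1 u
        map_add' := fun v w => hermInner_add_left v.1 w.1 u
        map_smul' := fun a v => hermInner_smul_left a v.1 u }
    have hker : (LinearMap.ker f).map (hermHull (shorten C {i})).subtype ≤ hermHull C := by
      rintro _ ⟨v, hv, rfl⟩
      exact mem_hermHull_of_mem_hermHull_shorten hu hui v.2 (hermInner_comm_eq_zero hv)
    have hmono := Submodule.finrank_mono hker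
    have hrange := Submodule.finrank_le (LinearMap.range f)
    have hadd := LinearMap.finrank_range_add_finrank_ker f
    rw [Submodule.finrank_map_subtype_eq] at hmono
    rw [Module.finrank_self] at hrange
    omega

end OneDimensionalHull

section HullBounds

variable {n m k l d : ℕ} {C : Submodule F4 (Fin n → F4)} {S : Finset (Fin n)}

/-- The conditions on a sequence `A` that hold for the weight distribution of an `[m, k]` code of
minimum distance at least `d` whose hull has dimension `l`. -/
structure HullWeightConstraints (m k l d : ℕ) (A : ℕ → ℕ) : Prop
    extends WeightConstraints m k d A where
  alternating : ∑ w ∈ Finset.range (m + 1), (A w : ℤ) * (-1) ^ w = (-2) ^ (k + l)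

lemma MinDistGE.hullWeightConstraints (hd : MinDistGE C d) (hS : SupportedOn C S) :
    HullWeightConstraints S.card (Module.finrank F4 C) (Module.finrank F4 (hermHull C)) d
      (weightCount C) where
  toWeightConstraints := hd.weightConstraints hS
  alternating := by rw [hS.sum_weightCount_mul_neg_one_pow, signedCount_eq]

namespace HullWeightConstraints

variable {A : ℕ → ℕ}

lemma not_5_2_1_4 : ¬ HullWeightConstraints 5 2 1 4 A := by
  intro hA
  have hs := hA.alternating
  have e0 := hA.moment 0 (by norm_num) (.of_excluded_sporadic (by decide))
  have e1 := hA.moment 1 (by norm_num) (.of_excluded_sporadic (by decide))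
  simp [Finset.sum_range_succ, hA.zero, hA.eq_zero, Nat.choose] at hs e0 e1
  omega

lemma not_5_3_1_3 : ¬ HullWeightConstraints 5 3 1 3 A := by
  intro hA
  have hs := hA.alternating
  have e0 := hA.moment 0 (by norm_num) (.of_excluded_sporadic (by decide))
  have e1 := hA.moment 1 (by norm_num) (.of_excluded_sporadic (by decide))
  have e2 := hA.moment 2 (by norm_num) (.of_excluded_sporadic (by decide))
  simp [Finset.sum_range_succ, hA.zero, hA.eq_zero, Nat.choose] at hs e0 e1 e2
  omega

lemma not_6_3_1_4 : ¬ HullWeightConstraints 6 3 1 4 A := by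
  intro hA
  have hs := hA.alternating
  have e0 := hA.moment 0 (by norm_num) (.of_excluded_sporadic (by decide))
  have e1 := hA.moment 1 (by norm_num) (.of_excluded_sporadic (by decide))
  have e2 := hA.moment 2 (by norm_num) (.of_excluded_sporadic (by decide))
  simp [Finset.sum_range_succ, hA.zero, hA.eq_zero, Nat.choose] at hs e0 e1 e2
  omega

lemma not_8_2_1_6 : ¬ HullWeightConstraints 8 2 1 6 A := by
  intro hA
  have hs := hA.alternating
  have e0 := hA.moment 0 (by norm_num) (.of_excluded_sporadic (by decide))
  have e1 := hA.moment 1 (by norm_num) (.of_excluded_sporadic (by decide))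
  simp [Finset.sum_range_succ, hA.zero, hA.eq_zero, Nat.choose] at hs e0 e1
  omega

lemma not_10_2_1_8 : ¬ HullWeightConstraints 10 2 1 8 A := by
  intro hA
  have hs := hA.alternating
  have e0 := hA.moment 0 (by norm_num) (.of_excluded_sporadic (by decide))
  have e1 := hA.moment 1 (by norm_num) (.of_excluded_sporadic (by decide))
  simp [Finset.sum_range_succ, hA.zero, hA.eq_zero, Nat.choose] at hs e0 e1
  omega

lemma nine_eq (hA : HullWeightConstraints 9 3 l 6 A) (hl : l ≤ 2) :
    A 9 = if l = 0 then 9 else 6 := by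
  have hs := hA.alternating
  have e0 := hA.moment 0 (by norm_num) (.of_excluded_sporadic (by decide))
  have e1 := hA.moment 1 (by norm_num) (.of_excluded_sporadic (by decide))
  have e2 := hA.moment 2 (by norm_num) (.of_excluded_sporadic (by decide))
  interval_cases l <;>
  · simp [Finset.sum_range_succ, hA.zero, hA.eq_zero, Nat.choose] at hs e0 e1 e2 ⊢
    omega

lemma ten_eq (hA : HullWeightConstraints 10 4 l 6 A) (hl : l = 0 ∨ l = 2) :
    A 10 = if l = 0 then 15 else 18 := by
  have hs := hA.alternating
  have e0 := hA.moment 0 (by norm_num) (.of_excluded_sporadic (by decide))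
  have e1 := hA.moment 1 (by norm_num) (.of_excluded_sporadic (by decide))
  have e2 := hA.moment 2 (by norm_num) (.of_excluded_sporadic (by decide))
  have e3 := hA.moment 3 (by norm_num) (.of_excluded_sporadic (by decide))
  obtain rfl | rfl := hl <;>
  · simp [Finset.sum_range_succ, hA.zero, hA.eq_zero, Nat.choose] at hs e0 e1 e2 e3 ⊢
    omega

lemma sub_nine_mul_nine_ne (hA : HullWeightConstraints 10 4 1 6 A) {w : ℕ} (h6 : 6 ≤ w)
    (h10 : w ≤ 10) : (10 - 9) * A 9 ≠ 6 * (10 - w) + 9 * w := by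
  intro h9
  have hs := hA.alternating
  have e0 := hA.moment 0 (by norm_num) (.of_excluded_sporadic (by decide))
  have e1 := hA.moment 1 (by norm_num) (.of_excluded_sporadic (by decide))
  have e2 := hA.moment 2 (by norm_num) (.of_excluded_sporadic (by decide))
  have e3 := hA.moment 3 (by norm_num) (.of_excluded_sporadic (by decide))
  simp [Finset.sum_range_succ, hA.zero, hA.eq_zero, Nat.choose] at hs e0 e1 e2 e3
  omega

lemma eq_six_of_sub_ten_mul_ten_eq (hA : HullWeightConstraints 11 5 1 6 A) {w : ℕ}
    (h11 : w ≤ 11) (h10 : (11 - 10) * A 10 = 18 * (11 - w) + 15 * w) : w = 6 := by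
  have hs := hA.alternating
  have e0 := hA.moment 0 (by norm_num) (.of_excluded_sporadic (by decide))
  have e1 := hA.moment 1 (by norm_num) (.of_excluded_sporadic (by decide))
  have e2 := hA.moment 2 (by norm_num) (.of_excluded_sporadic (by decide))
  have e3 := hA.moment 3 (by norm_num) (.of_excluded_sporadic (by decide))
  have e4 := hA.moment 4 (by norm_num) (.of_excluded_sporadic (by decide))
  simp [Finset.sum_range_succ, hA.zero, hA.eq_zero, Nat.choose] at hs e0 e1 e2 e3 e4
  omega

end HullWeightConstraints

/-- The shortening at `i` has a trivial hull exactly if `h i ≠ 0`, so summing over all `i` brings in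
the weight of `h`. -/
lemma weightCount_shorten_singleton {h : Fin n → F4} {w a b : ℕ} (hS : SupportedOn C S)
    (hd : MinDistGE C d) (hcard : S.card = m + 1) (hdim : Module.finrank F4 C = k + 1)
    (hno : NoCode F4 m (k + 1) d) (h0 : h ≠ 0) (hh : hermHull C = Submodule.span F4 {h})
    (hcount : ∀ i ∈ S, HullWeightConstraints m k (Module.finrank F4 (hermHull (shorten C {i}))) d
      (weightCount (shorten C {i})) → Module.finrank F4 (hermHull (shorten C {i})) ≤ 2 →
      weightCount (shorten C {i}) w =
        if Module.finrank F4 (hermHull (shorten C {i})) = 0 then b else a) :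
    (S.card - w) * weightCount C w = a * (S.card - hammingNorm h) + b * hammingNorm h := by
  have hmem : h ∈ hermHull C := hh ▸ Submodule.mem_span_singleton_self h
  refine hS.sub_mul_weightCount (hS h hmem.1) fun i hi => ?_
  have hA := (hd.shorten {i}).hullWeightConstraints (hS.shorten {i})
  rw [finrank_shorten_singleton hS hd hi (by rwa [hcard, hdim]), hdim,
    Finset.card_sdiff_of_subset (Finset.singleton_subset_iff.2 hi), hcard,
    Finset.card_singleton, Nat.add_sub_cancel, Nat.add_sub_cancel] at hA
  have hle := finrank_hermHull_shorten_singleton_le C i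
  rw [hh, finrank_span_singleton h0] at hle
  rw [hcount i hi hA hle]
  by_cases hi0 : h i = 0
  · rw [if_pos hi0, if_neg fun hz =>
      hermHull_shorten_singleton_ne_bot hmem h0 hi0 (Submodule.finrank_eq_zero.1 hz)]
  · rw [if_neg hi0, hermHull_shorten_singleton_eq_bot hh hi0, finrank_bot, if_pos rfl]

lemma finrank_hermHull_ne_one_of_10_4_6 (hS : SupportedOn C S) (hd : MinDistGE C 6)
    (hcard : S.card = 10) (hdim : Module.finrank F4 C = 4) :
    Module.finrank F4 (hermHull C) ≠ 1 := by
  intro hl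
  obtain ⟨h, h0, hh⟩ := exists_hermHull_eq_span hl
  have hmem : h ∈ C := (hh ▸ Submodule.mem_span_singleton_self h : h ∈ hermHull C).1
  have hcount := weightCount_shorten_singleton hS hd hcard hdim
    (.of_excluded_sporadic (by decide)) h0 hh fun i _ hA hl => hA.nine_eq hl
  have hA := hd.hullWeightConstraints hS
  have hle := hammingNorm_le_card_of_support (hS _ hmem)
  rw [hcard, hdim, hl] at hA
  rw [hcard] at hcount hle
  exact hA.sub_nine_mul_nine_ne (hd h hmem h0) hle hcount

lemma hammingNorm_eq_six_of_11_5_6 (hS : SupportedOn C S) (hd : MinDistGE C 6)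
    (hcard : S.card = 11) (hdim : Module.finrank F4 C = 5) {h : Fin n → F4} (h0 : h ≠ 0)
    (hh : hermHull C = Submodule.span F4 {h}) : hammingNorm h = 6 := by
  have hmem : h ∈ C := (hh ▸ Submodule.mem_span_singleton_self h : h ∈ hermHull C).1
  have hno : NoCode F4 10 5 6 := .of_excluded_sporadic (by decide)
  have hcount := weightCount_shorten_singleton hS hd hcard hdim hno h0 hh fun i hi hA hl => by
    have hne := finrank_hermHull_ne_one_of_10_4_6 (hS.shorten {i}) (hd.shorten {i})
      (by rw [Finset.card_sdiff_of_subset (Finset.singleton_subset_iff.2 hi), hcard,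
        Finset.card_singleton])
      (by rw [finrank_shorten_singleton hS hd hi (by rwa [hcard, hdim]), hdim])
    exact hA.ten_eq (by omega)
  have hA := hd.hullWeightConstraints hS
  have hle := hammingNorm_le_card_of_support (hS _ hmem)
  rw [hcard, hdim, hh, finrank_span_singleton h0] at hA
  rw [hcard] at hcount hle
  exact hA.eq_six_of_sub_ten_mul_ten_eq hle hcount

end HullBounds

section Fibres

variable {n : ℕ}

/-- The set of coordinates at which `x` takes the value `a`. -/
noncomputable def fibre (x : Fin n → F4) (a : F4) : Finset (Fin n) := {j | x j = a}

lemma mem_fibre {x : Fin n → F4} {a : F4} {j : Fin n} : j ∈ fibre x a ↔ x j = a := by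
  simp [fibre]

lemma card_fibre_add_hammingNorm (x : Fin n → F4) (a : F4) :
    (fibre x a).card + hammingNorm (x + fun _ => a) = n := by
  have hsplit := Finset.card_filter_add_card_filter_not (s := Finset.univ) (fun j => x j = a)
  simpa only [hammingNorm, fibre, Pi.add_apply, ne_eq, CharTwo.add_eq_zero, Finset.card_univ,
    Fintype.card_fin] using hsplit

/-- The number of coordinates where `x` differs from `a` is `∑ⱼ (xⱼ + a)³` in `F4`, which does not
depend on `a`. -/
lemma even_card_fibre_iff (hn : Even n) {x : Fin n → F4} (hx : ∑ j, x j = 0) (a : F4) :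
    Even (fibre x a).card ↔ hermInner x x = 0 := by
  have hself : hermInner (x + fun _ => a) (x + fun _ => a) = hermInner x x := by
    have hleft : hermInner x (fun _ => a) = 0 := by
      rw [hermInner, ← Finset.sum_mul, hx, zero_mul]
    have hconst : hermInner (fun _ : Fin n => a) (fun _ => a) = 0 := by
      rw [hermInner, Finset.sum_const, Finset.card_univ, Fintype.card_fin, nsmul_eq_mul,
        (natCast_F4_eq_zero_iff n).2 hn, zero_mul]
    simp only [hermInner_add_left, hermInner_add_right, hleft, hermInner_comm_eq_zero hleft,
      hconst, add_zero]
  rw [← hself, hermInner_self, natCast_F4_eq_zero_iff]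
  rw [← card_fibre_add_hammingNorm x a] at hn
  exact Nat.even_add.1 hn

/-- A word of length six is balanced if it takes every value at most twice. -/
def Balanced (x : Fin 6 → F4) : Prop := ∀ a, (fibre x a).card ≤ 2

lemma Balanced.hermInner_self {x : Fin 6 → F4} (hb : Balanced x) (hx : ∑ j, x j = 0) :
    hermInner x x = 0 := by
  have := Fintype.ofFinite F4
  by_contra hne
  have hone (a : F4) : (fibre x a).card ≤ 1 := by
    have hodd := mt (even_card_fibre_iff (by decide) hx a).1 hne
    rw [Nat.not_even_iff_odd] at hodd
    have := hb a
    obtain ⟨r, hr⟩ := hodd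
    omega
  have htotal := Finset.card_eq_sum_card_fiberwise (f := x) (s := Finset.univ) (t := Finset.univ)
    fun _ _ => Finset.mem_coe.2 (Finset.mem_univ _)
  have hle : ∑ a, (fibre x a).card ≤ Fintype.card F4 :=
    (Finset.sum_le_sum fun a _ => hone a).trans (by simp)
  rw [← Nat.card_eq_fintype_card, natCard_F4] at hle
  rw [Finset.card_univ, Fintype.card_fin] at htotal
  exact absurd (htotal.trans_le hle) (by norm_num)

lemma balanced_of_card_fibre_le_three {x : Fin 6 → F4} (hx : ∑ j, x j = 0)
    (hself : hermInner x x = 0) (h3 : ∀ a, (fibre x a).card ≤ 3) : Balanced x := by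
  intro a
  obtain ⟨r, hr⟩ := (even_card_fibre_iff (by decide) hx a).2 hself
  have := h3 a
  omega

end Fibres

section Hexacode

open Equiv (Perm)

/-- The words of length six whose second half is the first half `z`, rearranged by `π`, after
multiplying by `c ^ 2 = c + 1` and adding `c * (z 0 + z 1 + z 2)`. When `c ^ 2 = c + 1`, this is
the hexacode up to a monomial transformation. -/
def hexacode (c : F4) (π : Perm (Fin 3)) : Submodule F4 (Fin (3 + 3) → F4) where
  carrier := {z | ∀ j, z (Fin.natAdd 3 (π j)) =
    c * ∑ i, z (Fin.castAdd 3 i) + (c + 1) * z (Fin.castAdd 3 j)}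
  zero_mem' := by simp
  add_mem' := by
    intro y z hy hz j
    simp only [Pi.add_apply, Finset.sum_add_distrib, hy j, hz j]
    ring
  smul_mem' := by
    intro a z hz j
    simp only [Pi.smul_apply, smul_eq_mul, ← Finset.mul_sum, hz j]
    ring

variable {c c' : F4} {π π' : Perm (Fin 3)} {x y z : Fin (3 + 3) → F4}

lemma mem_hexacode : z ∈ hexacode c π ↔ ∀ j, z (Fin.natAdd 3 (π j)) =
    c * ∑ i, z (Fin.castAdd 3 i) + (c + 1) * z (Fin.castAdd 3 j) := Iff.rfl

lemma finrank_hexacode_le (c : F4) (π : Perm (Fin 3)) :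
    Module.finrank F4 (hexacode c π) ≤ 3 := by
  let f := (LinearMap.funLeft F4 F4 (Fin.castAdd 3)).comp (hexacode c π).subtype
  have hf : Function.Injective f := by
    refine (injective_iff_map_eq_zero f).2 fun z hz => Subtype.ext (funext fun p => ?_)
    have hleft (j : Fin 3) : z.1 (Fin.castAdd 3 j) = 0 := congrFun hz j
    refine Fin.addCases hleft (fun q => ?_) p
    obtain ⟨j, rfl⟩ := π.surjective q
    rw [mem_hexacode.1 z.2 j]
    simp [hleft]
  simpa using LinearMap.finrank_le_finrank_of_injective hf

/-- The sign of `π` together with the choice between the two primitive elements of `F4`. -/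
def hexacodeColour (c : F4) (π : Perm (Fin 3)) : Prop := c = ω ↔ π.sign = 1

lemma eq_const_of_left_eq {a : F4} (hz : z ∈ hexacode c π)
    (ha : ∀ j, z (Fin.castAdd 3 j) = a) : z = fun _ => a := by
  funext p
  refine Fin.addCases ha (fun q => ?_) p
  obtain ⟨j, rfl⟩ := π.surjective q
  rw [mem_hexacode.1 hz j, Fin.sum_univ_three, ha, ha, ha, ha]
  linear_combination (2 * a * c) * two_eq_zero

lemma perm_three_orbit : ∀ σ : Perm (Fin 3), σ.sign = 1 → σ ≠ 1 →
    ∀ j, j = 0 ∨ j = σ 0 ∨ j = σ (σ 0) := by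
  decide

lemma perm_three_involutive : ∀ σ : Perm (Fin 3), σ.sign ≠ 1 → ∀ j, σ (σ j) = j := by
  decide

lemma exists_eq_const_of_mem_hexacode_same (hc : c ^ 2 = c + 1) (hz : z ∈ hexacode c π)
    (hz' : z ∈ hexacode c π') (hne : π ≠ π') (hsign : π.sign = π'.sign) :
    ∃ a, z = fun _ => a := by
  have hc1 : c + 1 ≠ 0 := fun h => by
    rw [h, CharTwo.add_eq_zero.1 h] at hc
    simp at hc
  have hσ (j : Fin 3) : z (Fin.castAdd 3 ((π'⁻¹ * π) j)) = z (Fin.castAdd 3 j) := by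
    have h := mem_hexacode.1 hz' ((π'⁻¹ * π) j)
    rw [← Perm.mul_apply, mul_inv_cancel_left, mem_hexacode.1 hz j] at h
    exact (mul_left_cancel₀ hc1 (add_left_cancel h)).symm
  refine ⟨z (Fin.castAdd 3 0), eq_const_of_left_eq hz fun j => ?_⟩
  obtain rfl | rfl | rfl := perm_three_orbit (π'⁻¹ * π)
    (by rw [Equiv.Perm.sign_mul, Equiv.Perm.sign_inv, hsign, Int.units_mul_self])
    (fun h => hne (inv_mul_eq_one.1 h).symm) j
  exacts [rfl, hσ 0, (hσ _).trans (hσ 0)]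

lemma exists_eq_const_of_mem_hexacode_conj (hz : z ∈ hexacode c π)
    (hz' : z ∈ hexacode (c + 1) π') (hsign : π.sign ≠ π'.sign) : ∃ a, z = fun _ => a := by
  set s := ∑ i, z (Fin.castAdd 3 i) with hs
  have hσ (j : Fin 3) : s =
      (c + 1) * z (Fin.castAdd 3 j) + c * z (Fin.castAdd 3 ((π'⁻¹ * π) j)) := by
    have h := mem_hexacode.1 hz' ((π'⁻¹ * π) j)
    rw [← Perm.mul_apply, mul_inv_cancel_left, mem_hexacode.1 hz j, ← hs] at h
    linear_combination (-1) * h - (c + 1) * z (Fin.castAdd 3 ((π'⁻¹ * π) j)) * two_eq_zero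
  refine ⟨s, eq_const_of_left_eq hz fun j => ?_⟩
  have hj := hσ j
  have hσj := hσ ((π'⁻¹ * π) j)
  rw [perm_three_involutive _ (fun h => hsign ?_)] at hσj
  · linear_combination (-c - 1) * hj - c * hσj + (c * s - c * (c + 1) *
      (z (Fin.castAdd 3 j) + z (Fin.castAdd 3 ((π'⁻¹ * π) j)))) * two_eq_zero
  · rw [Equiv.Perm.sign_mul, Equiv.Perm.sign_inv, ← Int.units_inv_eq_self π'.sign,
      inv_mul_eq_one] at h
    exact h.symm

lemma eq_or_eq_add_one {a b : F4} (ha : a ^ 2 = a + 1) (hb : b ^ 2 = b + 1) :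
    a = b ∨ a = b + 1 := by
  have hfactor : (a - b) * (a - (b + 1)) = 0 := by
    linear_combination ha - hb + (b ^ 2 - a * b) * two_eq_zero
  exact (mul_eq_zero.1 hfactor).imp sub_eq_zero.1 sub_eq_zero.1

/-- The hexacodes of one colour pairwise meet in the constant words. -/
lemma not_hexacodeColour_iff (hc : c ^ 2 = c + 1) (hc' : c' ^ 2 = c' + 1) (hz : z ∈ hexacode c π)
    (hz' : z ∈ hexacode c' π') (hconst : ∀ a, z ≠ fun _ => a)
    (hne : (c, π) ≠ (c', π')) : ¬(hexacodeColour c π ↔ hexacodeColour c' π') := by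
  have hsigns : π.sign = 1 ∨ π.sign = -1 := Int.units_eq_one_or _
  have hsigns' : π'.sign = 1 ∨ π'.sign = -1 := Int.units_eq_one_or _
  obtain rfl | hcc := eq_or_ne c c'
  · have hsign : π.sign ≠ π'.sign := fun h => by
      obtain ⟨a, ha⟩ := exists_eq_const_of_mem_hexacode_same hc hz hz' (fun h => hne (by rw [h])) h
      exact hconst a ha
    unfold hexacodeColour
    grind
  · obtain rfl : c' = c + 1 := (eq_or_eq_add_one hc' hc).resolve_left hcc.symm
    have hsign : π.sign = π'.sign := by
      by_contra h
      obtain ⟨a, ha⟩ := exists_eq_const_of_mem_hexacode_conj hz hz' h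
      exact hconst a ha
    have hω : c + 1 = ω ↔ c ≠ ω := by
      refine ⟨?_, fun h => ?_⟩
      · rintro h rfl
        simp at h
      · rw [(eq_or_eq_add_one hc ω_sq).resolve_left h, add_assoc, CharTwo.add_self_eq_zero,
          add_zero]
    unfold hexacodeColour
    grind

lemma sq_eq_add_one {a : F4} (h0 : a ≠ 0) (h1 : a ≠ 1) : a ^ 2 = a + 1 := by
  have hfactor : (a - 1) * (a ^ 2 - (a + 1)) = 0 := by
    linear_combination pow_three_eq_one h0 + (1 - a ^ 2) * two_eq_zero
  exact sub_eq_zero.1 ((mul_eq_zero.1 hfactor).resolve_left (sub_ne_zero.2 h1))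

section Word

variable {j : Fin 3}

lemma exists_ne_eq_of_even_card_fibre (heven : ∀ a, Even (fibre z a).card) (p : Fin (3 + 3)) :
    ∃ q ≠ p, z q = z p := by
  have hmem : p ∈ fibre z (z p) := mem_fibre.2 rfl
  have hcard : 1 < (fibre z (z p)).card := by
    have hpos := Finset.card_pos.2 ⟨p, hmem⟩
    obtain ⟨r, hr⟩ := heven (z p)
    omega
  obtain ⟨q, hq, hqp⟩ := Finset.exists_mem_ne hcard p
  exact ⟨q, hqp, mem_fibre.1 hq⟩

lemma Balanced.ne_of_eq (hb : Balanced z) {p q r : Fin (3 + 3)} (hpq : p ≠ q) (hpr : p ≠ r)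
    (hqr : q ≠ r) (h : z p = z q) : z p ≠ z r := by
  intro h'
  have hlt := Finset.two_lt_card.2 ⟨p, mem_fibre.2 rfl, q, mem_fibre.2 h.symm, r,
    mem_fibre.2 h'.symm, hpq, hpr, hqr⟩
  exact (hb (z p)).not_gt hlt

lemma fin_three_add : ∀ i : Fin 3,
    i + 1 ≠ i ∧ i + 2 ≠ i ∧ i + 1 ≠ i + 2 ∧ ∀ q ≠ i, q ≠ i + 1 → q = i + 2 := by
  decide

lemma castAdd_ne_natAdd : ∀ i q : Fin 3, Fin.castAdd 3 i ≠ Fin.natAdd 3 q := by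
  decide

lemma right_ne_zero (hb : Balanced z) (hz : ∀ i, z (Fin.castAdd 3 i) = if i = j then 1 else 0)
    (q : Fin 3) : z (Fin.natAdd 3 q) ≠ 0 := by
  have hj := fin_three_add j
  have h1 : z (Fin.castAdd 3 (j + 1)) = 0 := by rw [hz, if_neg hj.1]
  have h2 : z (Fin.castAdd 3 (j + 2)) = 0 := by rw [hz, if_neg hj.2.1]
  rw [← h1]
  exact (hb.ne_of_eq (fun h => hj.2.2.1 (Fin.castAdd_injective 3 3 h)) (castAdd_ne_natAdd _ _)
    (castAdd_ne_natAdd _ _) (h1.trans h2.symm)).symm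

lemma exists_right_eq_one (hb : Balanced z) (heven : ∀ a, Even (fibre z a).card)
    (hz : ∀ i, z (Fin.castAdd 3 i) = if i = j then 1 else 0) :
    ∃ p : Fin 3, ∀ q, z (Fin.natAdd 3 q) = 1 ↔ q = p := by
  have hone : z (Fin.castAdd 3 j) = 1 := by rw [hz, if_pos rfl]
  obtain ⟨p, hpj, hp⟩ := exists_ne_eq_of_even_card_fibre heven (Fin.castAdd 3 j)
  induction p using Fin.addCases with
  | left i =>
    rw [hone, hz, if_neg fun h => hpj (by rw [h])] at hp
    exact absurd hp zero_ne_one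
  | right p =>
    refine ⟨p, fun q => ⟨fun hq => ?_, fun h => h ▸ hp.trans hone⟩⟩
    by_contra hqp
    exact hb.ne_of_eq (castAdd_ne_natAdd _ _) (castAdd_ne_natAdd _ _)
      (fun h => hqp (Fin.natAdd_injective 3 3 h).symm) hp.symm (hone.trans hq.symm)

/-- The value `0` already occurs twice on the left, so `1` occurs once on the right and the
remaining value occurs twice there. -/
lemma exists_right_eq (hb : Balanced z) (heven : ∀ a, Even (fibre z a).card)
    (hz : ∀ i, z (Fin.castAdd 3 i) = if i = j then 1 else 0) :
    ∃ p c, c ^ 2 = c + 1 ∧ ∀ q, z (Fin.natAdd 3 q) = if q = p then 1 else c := by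
  obtain ⟨p, hp⟩ := exists_right_eq_one hb heven hz
  have hthree := fin_three_add p
  have hne1 : z (Fin.natAdd 3 (p + 1)) ≠ 1 := fun h => hthree.1 ((hp _).1 h)
  obtain ⟨q, hq, hqc⟩ := exists_ne_eq_of_even_card_fibre heven (Fin.natAdd 3 (p + 1))
  induction q using Fin.addCases with
  | left i =>
    rw [hz] at hqc
    split_ifs at hqc
    exacts [absurd hqc.symm hne1, absurd hqc.symm (right_ne_zero hb hz _)]
  | right q =>
    have hqp : q ≠ p := fun h => hne1 (hqc.symm.trans ((hp q).2 h))
    obtain rfl := hthree.2.2.2 q hqp fun h => hq (by rw [h])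
    refine ⟨p, _, sq_eq_add_one (right_ne_zero hb hz (p + 1)) hne1, fun r => ?_⟩
    split_ifs with h
    · exact (hp r).2 h
    · obtain rfl | hr := eq_or_ne r (p + 1)
      · rfl
      · rw [hthree.2.2.2 r h hr, hqc]

end Word

variable {D : Submodule F4 (Fin (3 + 3) → F4)}

lemma eq_zero_of_left_eq_zero {z : Fin (3 + 3) → F4} (hbal : (∀ a, z ≠ fun _ => a) → Balanced z)
    (hz : ∀ j, z (Fin.castAdd 3 j) = 0) : z = 0 := by
  by_cases hconst : ∃ a, z = fun _ => a
  · obtain ⟨a, rfl⟩ := hconst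
    exact funext fun _ => hz 0
  · have hne : ∀ i j : Fin 3, i ≠ j → Fin.castAdd 3 i ≠ Fin.castAdd 3 j := by decide
    exact absurd ((hz 0).trans (hz 2).symm) ((hbal (not_exists.1 hconst)).ne_of_eq
      (hne 0 1 (by decide)) (hne 0 2 (by decide)) (hne 1 2 (by decide)) ((hz 0).trans (hz 1).symm))

lemma exists_mem_left_eq_single (hdim : 3 ≤ Module.finrank F4 D) (hsum : ∀ z ∈ D, ∑ p, z p = 0)
    (hbal : ∀ z ∈ D, (∀ a, z ≠ fun _ => a) → Balanced z) (j : Fin 3) :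
    ∃ z ∈ D, ∃ p c, c ^ 2 = c + 1 ∧ (∀ i, z (Fin.castAdd 3 i) = if i = j then 1 else 0) ∧
      ∀ q, z (Fin.natAdd 3 q) = if q = p then 1 else c := by
  let left := (LinearMap.funLeft F4 F4 (Fin.castAdd 3)).comp D.subtype
  have hinj : Function.Injective left := (injective_iff_map_eq_zero left).2 fun z hz =>
    Subtype.ext (eq_zero_of_left_eq_zero (hbal z.1 z.2) (congrFun hz))
  have hdim' : Module.finrank F4 D = Module.finrank F4 (Fin 3 → F4) :=
    (LinearMap.finrank_le_finrank_of_injective hinj).antisymm (by simpa using hdim)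
  obtain ⟨⟨z, hzD⟩, hz⟩ :=
    (LinearMap.injective_iff_surjective_of_finrank_eq_finrank hdim').1 hinj (Pi.single j 1)
  have hleft (i : Fin 3) : z (Fin.castAdd 3 i) = if i = j then 1 else 0 :=
    (congrFun hz i).trans (Pi.single_apply j 1 i)
  have hb : Balanced z := hbal z hzD fun a ha => by
    have h0 := hleft j
    have h1 := hleft (j + 1)
    rw [if_pos rfl, ha] at h0
    rw [if_neg (fin_three_add j).1, ha] at h1
    exact one_ne_zero (h0.symm.trans h1)
  obtain ⟨p, c, hc, hright⟩ := exists_right_eq hb (fun a =>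
    (even_card_fibre_iff (by decide) (hsum z hzD) a).2 (hb.hermInner_self (hsum z hzD))) hleft
  exact ⟨z, hzD, p, c, hc, hleft, hright⟩

lemma sum_ne_one_of_sq_eq_add_one {u : Fin 3 → F4} (hu : ∀ j, u j ^ 2 = u j + 1) :
    ∑ j, u j ≠ 1 := by
  intro h
  rw [Fin.sum_univ_three] at h
  refine one_ne_zero (α := F4) ?_
  linear_combination hu 0 + hu 1 + hu 2 + (u 0 + u 1 + u 2) * h +
    (2 + u 0 + u 1 + u 2 - u 0 ^ 2 - u 1 ^ 2 - u 2 ^ 2 - u 0 * u 1 - u 0 * u 2 - u 1 * u 2) *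
      two_eq_zero

lemma exists_le_hexacode (hdim : 3 ≤ Module.finrank F4 D) (hone : (fun _ => 1) ∈ D)
    (hsum : ∀ z ∈ D, ∑ p, z p = 0) (hbal : ∀ z ∈ D, (∀ a, z ≠ fun _ => a) → Balanced z) :
    ∃ c π, c ^ 2 = c + 1 ∧ D ≤ hexacode c π := by
  choose E hED π u hu hleft hright using exists_mem_left_eq_single hdim hsum hbal
  have hexpand {z} (hz : z ∈ D) (q : Fin 3) : z (Fin.natAdd 3 q) =
      ∑ j, z (Fin.castAdd 3 j) * if q = π j then 1 else u j := by
    have hmem : z - ∑ j, z (Fin.castAdd 3 j) • E j ∈ D :=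
      D.sub_mem hz (D.sum_mem fun j _ => D.smul_mem _ (hED j))
    have hzero := eq_zero_of_left_eq_zero (hbal _ hmem) fun i => by
      simp [Finset.sum_apply, hleft]
    simp only [congrFun (sub_eq_zero.1 hzero) (Fin.natAdd 3 q), Finset.sum_apply, Pi.smul_apply,
      smul_eq_mul, hright]
  have hrow (q : Fin 3) : ∑ j, (if q = π j then 1 else u j) = 1 := by
    simpa only [one_mul] using (hexpand hone q).symm
  have hsurj : Function.Surjective π := fun q => by
    by_contra! hq
    refine sum_ne_one_of_sq_eq_add_one hu ((Finset.sum_congr rfl fun j _ => ?_).trans (hrow q))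
    rw [if_neg (hq j).symm]
  have hinj : Function.Injective π := Finite.injective_iff_surjective.2 hsurj
  have hconst (j : Fin 3) : u j = u 0 := by
    have h1 := hrow (π 1)
    have h2 := hrow (π 2)
    simp only [Fin.sum_univ_three, hinj.eq_iff, Fin.reduceEq, if_false, if_true] at h1 h2
    match j with
    | 0 => rfl
    | 1 => linear_combination h2 - u 0 * two_eq_zero
    | 2 => linear_combination h1 - u 0 * two_eq_zero
  refine ⟨u 0, Equiv.ofBijective π ⟨hinj, hsurj⟩, hu 0, fun z hz j => ?_⟩
  have hterm (i : Fin 3) : (z (Fin.castAdd 3 i) * if j = i then 1 else u 0) =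
      u 0 * z (Fin.castAdd 3 i) + if j = i then (u 0 + 1) * z (Fin.castAdd 3 i) else 0 := by
    split_ifs
    · linear_combination (-u 0 * z (Fin.castAdd 3 i)) * two_eq_zero
    · ring
  refine (hexpand hz (π j)).trans ?_
  simp only [hinj.eq_iff, hconst, hterm, Finset.sum_add_distrib, Finset.mul_sum,
    Finset.sum_ite_eq, Finset.mem_univ, if_true]

end Hexacode

section Triples

open Finset

lemma two_le_card_inter {T T' : Finset (Fin 5)} {x : Fin 5} (hT : T.card = 3) (hT' : T'.card = 3)
    (hx : x ∉ T) (hx' : x ∉ T') : 2 ≤ (T ∩ T').card := by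
  have hsub : T ∪ T' ⊆ {x}ᶜ := fun y hy => by
    rw [mem_compl, mem_singleton]
    rintro rfl
    exact (mem_union.1 hy).elim hx hx'
  have hunion := card_le_card hsub
  rw [card_compl, card_singleton, Fintype.card_fin] at hunion
  have := card_union_add_card_inter T T'
  omega

/-- Every triple avoids exactly two points, and among the triples avoiding a given point the two
colours occur equally often. -/
lemma even_card_of_forall_even_card {Z : Finset (Finset (Fin 5))} (hZ : ∀ T ∈ Z, T.card = 3)
    (χ : Finset (Fin 5) → Prop)
    (hχ : ∀ T ∈ Z, ∀ T' ∈ Z, T ≠ T' → 2 ≤ (T ∩ T').card → ¬(χ T ↔ χ T'))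
    (heven : ∀ x, Even (#{T ∈ Z | x ∉ T})) : Even (#Z) := by
  have := Classical.decPred χ
  have hle_one (x : Fin 5) (q : Finset (Fin 5) → Prop) [DecidablePred q]
      (hq : ∀ T T', q T → q T' → (χ T ↔ χ T')) : #(filter q {T ∈ Z | x ∉ T}) ≤ 1 := by
    refine card_le_one.2 fun T hT T' hT' => ?_
    simp only [mem_filter] at hT hT'
    by_contra hne
    exact hχ T hT.1.1 T' hT'.1.1 hne
      (two_le_card_inter (hZ T hT.1.1) (hZ T' hT'.1.1) hT.1.2 hT'.1.2) (hq T T' hT.2 hT'.2)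
  have hbalance (x : Fin 5) :
      #{T ∈ {T ∈ Z | χ T} | x ∉ T} = #{T ∈ {T ∈ Z | ¬χ T} | x ∉ T} := by
    have hsplit := card_filter_add_card_filter_not (s := {T ∈ Z | x ∉ T}) χ
    have h1 := hle_one x χ fun T T' h h' => iff_of_true h h'
    have h0 := hle_one x (¬χ ·) fun T T' h h' => iff_of_false h h'
    obtain ⟨r, hr⟩ := heven x
    rw [filter_comm χ, filter_comm (¬χ ·)]
    omega
  have hcount (q : Finset (Fin 5) → Prop) [DecidablePred q] :
      ∑ x, #{T ∈ {T ∈ Z | q T} | x ∉ T} = 2 * #{T ∈ Z | q T} := by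
    simp only [card_filter _ (filter q Z)]
    rw [sum_comm, mul_comm, ← smul_eq_mul, ← sum_const]
    refine sum_congr rfl fun T hT => ?_
    rw [← card_filter, filter_not, filter_mem_eq_inter, univ_inter, ← compl_eq_univ_sdiff,
      card_compl, hZ T (mem_filter.1 hT).1, Fintype.card_fin]
  have hdouble := (hcount χ).symm.trans ((sum_congr rfl fun x _ => hbalance x).trans (hcount _))
  rw [← card_filter_add_card_filter_not (s := Z) χ, mul_left_cancel₀ two_ne_zero hdouble]
  exact Even.add_self _

/-- The sum of `γ i j` over the pairs `i < j` in `T`. -/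
noncomputable def pairSum (γ : Fin 5 → Fin 5 → F4) (T : Finset (Fin 5)) : F4 :=
  ∑ p : Fin 5 × Fin 5 with p.1 < p.2 ∧ p.1 ∈ T ∧ p.2 ∈ T, γ p.1 p.2

variable {γ : Fin 5 → Fin 5 → F4}

lemma exists_lt_lt_eq_of_card_eq_three : ∀ T : Finset (Fin 5), T.card = 3 →
    ∃ i j k, i < j ∧ j < k ∧ T = {i, j, k} := by
  decide

lemma filter_pairs_triple : ∀ i j k : Fin 5, i < j → j < k →
    ({p | p.1 < p.2 ∧ p.1 ∈ ({i, j, k} : Finset (Fin 5)) ∧ p.2 ∈ ({i, j, k} : Finset (Fin 5))} :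
      Finset (Fin 5 × Fin 5)) = {(i, j), (i, k), (j, k)} := by
  decide

lemma pairSum_triple {i j k : Fin 5} (hij : i < j) (hjk : j < k) :
    pairSum γ {i, j, k} = γ i j + γ i k + γ j k := by
  rw [pairSum, filter_pairs_triple i j k hij hjk, sum_insert, sum_insert, sum_singleton, add_assoc]
  · simp [hij.ne]
  · simp [hjk.ne, hij.ne]

lemma sum_pairSum (S : Finset (Finset (Fin 5))) : ∑ T ∈ S, pairSum γ T =
    ∑ p : Fin 5 × Fin 5 with p.1 < p.2, (#{T ∈ S | p.1 ∈ T ∧ p.2 ∈ T} : F4) * γ p.1 p.2 := by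
  have h (T : Finset (Fin 5)) : pairSum γ T = ∑ p : Fin 5 × Fin 5 with p.1 < p.2,
      if p.1 ∈ T ∧ p.2 ∈ T then γ p.1 p.2 else 0 := by
    rw [pairSum, ← sum_filter, filter_filter]
  simp only [h]
  rw [sum_comm]
  refine sum_congr rfl fun p _ => ?_
  rw [← sum_filter, sum_const, nsmul_eq_mul]

lemma card_triples_containing : ∀ i j : Fin 5, i < j →
    #{T ∈ powersetCard 3 univ | i ∈ T ∧ j ∈ T} = 3 := by
  decide

lemma even_card_triples_containing_avoiding : ∀ x i j : Fin 5, i < j →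
    Even (#{T ∈ {T ∈ powersetCard 3 univ | x ∉ T} | i ∈ T ∧ j ∈ T}) := by
  decide

lemma isIdempotentElem_add {x y : F4} (hx : IsIdempotentElem x) (hy : IsIdempotentElem y) :
    IsIdempotentElem (x + y) := by
  rw [IsIdempotentElem] at *
  linear_combination hx + hy + x * y * two_eq_zero

lemma natCast_card_filter_eq_zero {ι : Type*} (S : Finset ι) {t : ι → F4}
    (ht : ∀ T ∈ S, IsIdempotentElem (t T)) : (#{T ∈ S | t T = 0} : F4) = #S + ∑ T ∈ S, t T := by
  rw [natCast_card_filter, ← nsmul_one, ← sum_const, ← sum_add_distrib]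
  refine sum_congr rfl fun T hT => ?_
  obtain h | h := IsIdempotentElem.iff_eq_zero_or_one.1 (ht T hT) <;>
    simp [h, CharTwo.add_self_eq_zero]

lemma isIdempotentElem_pairSum (hγ : ∀ i j, IsIdempotentElem (γ i j)) (T : Finset (Fin 5)) :
    IsIdempotentElem (pairSum γ T) :=
  sum_induction _ _ (fun _ _ => isIdempotentElem_add) (mul_zero 0) fun p _ => hγ p.1 p.2

/-- The triples on which `pairSum γ` vanishes. -/
noncomputable def zeroTriples (γ : Fin 5 → Fin 5 → F4) : Finset (Finset (Fin 5)) :=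
  {T ∈ powersetCard 3 univ | pairSum γ T = 0}

lemma mem_zeroTriples {T : Finset (Fin 5)} :
    T ∈ zeroTriples γ ↔ T.card = 3 ∧ pairSum γ T = 0 := by
  simp [zeroTriples, mem_powersetCard]

lemma even_card_zeroTriples_avoiding (hγ : ∀ i j, IsIdempotentElem (γ i j)) (x : Fin 5) :
    Even (#{T ∈ zeroTriples γ | x ∉ T}) := by
  have hcard : ∀ x : Fin 5, #{T ∈ powersetCard 3 univ | x ∉ T} = 4 := by decide
  rw [zeroTriples, filter_comm, ← natCast_F4_eq_zero_iff,
    natCast_card_filter_eq_zero _ fun T _ => isIdempotentElem_pairSum hγ T, sum_pairSum, hcard,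
    (natCast_F4_eq_zero_iff 4).2 (by decide), zero_add]
  refine sum_eq_zero fun p hp => ?_
  rw [(natCast_F4_eq_zero_iff _).2
    (even_card_triples_containing_avoiding x p.1 p.2 (mem_filter.1 hp).2), zero_mul]

lemma natCast_card_zeroTriples (hγ : ∀ i j, IsIdempotentElem (γ i j)) :
    (#(zeroTriples γ) : F4) = ∑ p : Fin 5 × Fin 5 with p.1 < p.2, γ p.1 p.2 := by
  rw [zeroTriples, natCast_card_filter_eq_zero _ fun T _ => isIdempotentElem_pairSum hγ T,
    sum_pairSum, card_powersetCard, (natCast_F4_eq_zero_iff _).2 (by decide), zero_add]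
  refine sum_congr rfl fun p hp => ?_
  rw [card_triples_containing p.1 p.2 (mem_filter.1 hp).2]
  push_cast
  linear_combination γ p.1 p.2 * two_eq_zero

end Triples

lemma det_fin_four_eq_sq {R : Type*} [CommRing R] (A : Matrix (Fin 4) (Fin 4) R)
    (hdiag : ∀ i, A i i = 0) (hskew : ∀ i j, A j i = -A i j) :
    A.det = (A 0 1 * A 2 3 - A 0 2 * A 1 3 + A 0 3 * A 1 2) ^ 2 := by
  have hone : Fin.succAbove (1 : Fin 4) = ![0, 2, 3] := by decide
  have htwo : Fin.succAbove (2 : Fin 4) = ![0, 1, 3] := by decide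
  have hthree : Fin.succAbove (3 : Fin 4) = ![0, 1, 2] := by decide
  rw [Matrix.det_succ_row_zero]
  simp only [Fin.sum_univ_four, Matrix.det_fin_three, Matrix.submatrix_apply, Fin.succAbove_zero,
    hone, htwo, hthree, Matrix.cons_val, Fin.reduceSucc, Fin.coe_ofNat_eq_mod, hdiag, hskew 0 1,
    hskew 0 2, hskew 0 3, hskew 1 2, hskew 1 3, hskew 2 3]
  ring

/-- The five words cut out of an `[11, 5, 6]` code with hull spanned by a word `h` of weight `6`.
Each `b` with coordinate sum `0` on the five zeros of `h` extends to a codeword that restricts to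
`∑ i, b i • u i` on the six remaining coordinates, up to a multiple of `h`, after scaling `h` to the
all-one word. -/
structure ResidualWords (u : Fin 5 → Fin 6 → F4) : Prop where
  zero : u 0 = 0
  sum_eq_zero : ∀ i, ∑ j, u i j = 0
  card_le : ∀ b, b ≠ 0 → ∑ i, b i = 0 → ∀ a,
    (fibre (Fintype.linearCombination F4 u b) a).card ≤ hammingNorm b
  nondegenerate : ∀ b, ∑ i, b i = 0 →
    (∀ m, b 0 + b m + hermInner (Fintype.linearCombination F4 u b) (u m) = 0) → b = 0

namespace ResidualWords

variable {u : Fin 5 → Fin 6 → F4} {i j k : Fin 5} {c : F4} {π : Equiv.Perm (Fin 3)}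

lemma sum_linearCombination (hu : ResidualWords u) (b : Fin 5 → F4) :
    ∑ j, Fintype.linearCombination F4 u b j = 0 := by
  simp only [Fintype.linearCombination_apply, Finset.sum_apply, Pi.smul_apply, smul_eq_mul]
  rw [Finset.sum_comm]
  simp only [← Finset.mul_sum, hu.sum_eq_zero, mul_zero, Finset.sum_const_zero]

lemma linearCombination_ne_const (hu : ResidualWords u) {b : Fin 5 → F4} (hb : b ≠ 0)
    (hsum : ∑ i, b i = 0) (a : F4) : Fintype.linearCombination F4 u b ≠ fun _ => a := by
  intro h
  have hcard := (hu.card_le b hb hsum a).trans (hammingNorm_le_card_fintype (x := b))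
  have hfull : fibre (fun _ : Fin 6 => a) a = Finset.univ := by ext; simp [mem_fibre]
  rw [h, hfull] at hcard
  exact absurd hcard (by decide)

lemma linearCombination_single_add_single (i j : Fin 5) :
    Fintype.linearCombination F4 u (Pi.single i 1 + Pi.single j 1) = u i + u j := by
  rw [map_add, Fintype.linearCombination_apply_single, Fintype.linearCombination_apply_single,
    one_smul, one_smul]

lemma sum_single_add_single (i j : Fin 5) :
    ∑ m, (Pi.single i 1 + Pi.single j 1 : Fin 5 → F4) m = 0 := by
  simp [Finset.sum_add_distrib, CharTwo.add_self_eq_zero]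

lemma single_add_single_ne_zero (hij : i ≠ j) :
    (Pi.single i 1 + Pi.single j 1 : Fin 5 → F4) ≠ 0 := by
  intro h
  simpa [hij] using congrFun h i

lemma add_ne_const (hu : ResidualWords u) (hij : i ≠ j) (a : F4) : u i + u j ≠ fun _ => a := by
  rw [← linearCombination_single_add_single]
  exact hu.linearCombination_ne_const (single_add_single_ne_zero hij)
    (sum_single_add_single i j) a

lemma hermInner_add_self (hu : ResidualWords u) (hij : i ≠ j) :
    hermInner (u i + u j) (u i + u j) = 0 := by
  refine Balanced.hermInner_self (fun a => ?_) ?_ <;> rw [← linearCombination_single_add_single]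
  · refine (hu.card_le _ (single_add_single_ne_zero hij) (sum_single_add_single i j) a).trans
      ((hammingNorm_le_card_of_support (S := {i, j}) fun m hm => ?_).trans Finset.card_le_two)
    simp only [Finset.mem_insert, Finset.mem_singleton, not_or] at hm
    simp [hm.1, hm.2]
  · exact hu.sum_linearCombination _

lemma hermInner_self (hu : ResidualWords u) (i : Fin 5) : hermInner (u i) (u i) = 0 := by
  obtain rfl | hi := eq_or_ne i 0
  · rw [hu.zero]
    simp [hermInner]
  · simpa only [hu.zero, add_zero] using hu.hermInner_add_self hi

lemma hermInner_comm (hu : ResidualWords u) (i j : Fin 5) :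
    hermInner (u j) (u i) = hermInner (u i) (u j) := by
  obtain rfl | hij := eq_or_ne i j
  · rfl
  · have h := hu.hermInner_add_self hij
    simp only [hermInner_add_left, hermInner_add_right, hu.hermInner_self, zero_add, add_zero] at h
    exact CharTwo.add_eq_zero.1 h

lemma isIdempotentElem_hermInner (hu : ResidualWords u) (i j : Fin 5) :
    IsIdempotentElem (hermInner (u i) (u j)) := by
  rw [IsIdempotentElem, ← sq, ← Quaternary.hermInner_comm, hu.hermInner_comm]

lemma linearIndependent (hu : ResidualWords u) (i : Fin 5) :
    LinearIndependent F4 fun m => if m = i then (fun _ => 1) else u i + u m := by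
  refine Fintype.linearIndependent_iff.2 fun g hg => ?_
  let b : Fin 5 → F4 := ∑ m ∈ Finset.univ.erase i, g m • (Pi.single i 1 + Pi.single m 1)
  have hbm {m} (hm : m ≠ i) : b m = g m := by
    simp [b, Finset.sum_apply, Pi.single_apply, hm]
  have hsum : ∑ m, b m = 0 := by
    simp only [b, Finset.sum_apply, Pi.smul_apply]
    rw [Finset.sum_comm]
    simp only [← Finset.smul_sum, sum_single_add_single, smul_zero, Finset.sum_const_zero]
  have hb : Fintype.linearCombination F4 u b = fun _ => g i := by
    rw [← Finset.add_sum_erase _ _ (Finset.mem_univ i), if_pos rfl] at hg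
    simp only [b, map_sum, map_smul, linearCombination_single_add_single]
    rw [Finset.sum_congr rfl fun m hm => by rw [if_neg (Finset.ne_of_mem_erase hm)],
      CharTwo.add_eq_zero] at hg
    rw [← hg]
    exact funext fun _ => mul_one _
  have hb0 : b = 0 := by
    by_contra hne
    exact hu.linearCombination_ne_const hne hsum _ hb
  intro m
  obtain rfl | hm := eq_or_ne m i
  · rw [hb0, map_zero] at hb
    exact (congrFun hb 0).symm
  · rw [← hbm hm, hb0, Pi.zero_apply]

lemma card_le_finrank (hu : ResidualWords u) {D : Submodule F4 (Fin 6 → F4)}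
    (hone : (fun _ => 1) ∈ D) {S : Finset (Fin 5)} (hS : ∀ m ∈ S, u i + u m ∈ D) :
    S.card ≤ Module.finrank F4 D := by
  let x (m : S) : D := ⟨if m = i then (fun _ => 1) else u i + u m, by
    split_ifs
    exacts [hone, hS m m.2]⟩
  have hx : LinearIndependent F4 x := .of_comp D.subtype
    ((hu.linearIndependent i).comp ((↑) : S → Fin 5) Subtype.val_injective)
  simpa using hx.fintype_card_le_finrank

lemma balanced_smul_add_smul (hu : ResidualWords u) (hij : i ≠ j) (hik : i ≠ k)
    (h0 : hermInner (u i) (u j) + hermInner (u i) (u k) + hermInner (u j) (u k) = 0) {b c : F4}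
    (hne : b • (u i + u j) + c • (u i + u k) ≠ 0) :
    Balanced (b • (u i + u j) + c • (u i + u k)) := by
  let e : Fin 5 → F4 :=
    b • (Pi.single i 1 + Pi.single j 1) + c • (Pi.single i 1 + Pi.single k 1)
  have he : Fintype.linearCombination F4 u e = b • (u i + u j) + c • (u i + u k) := by
    simp only [e, map_add, map_smul, Fintype.linearCombination_apply_single, one_smul]
  have hesum : ∑ m, e m = 0 := by
    change ∑ m, (b * (Pi.single i 1 + Pi.single j 1 : Fin 5 → F4) m +
      c * (Pi.single i 1 + Pi.single k 1 : Fin 5 → F4) m) = 0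
    rw [Finset.sum_add_distrib, ← Finset.mul_sum, ← Finset.mul_sum, sum_single_add_single,
      sum_single_add_single, mul_zero, mul_zero, add_zero]
  rw [← he] at hne ⊢
  refine balanced_of_card_fibre_le_three (hu.sum_linearCombination e) ?_ fun a => ?_
  · have hcross : hermInner (u i + u j) (u i + u k) = 0 := by
      simp only [hermInner_add_left, hermInner_add_right, hu.hermInner_self]
      rw [hu.hermInner_comm i j]
      linear_combination h0
    rw [he]
    exact hermInner_smul_add_smul_self (hu.hermInner_add_self hij) (hu.hermInner_add_self hik)
      hcross b c
  · refine (hu.card_le e (fun h => hne (by rw [h, map_zero])) hesum a).trans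
      ((hammingNorm_le_card_of_support (S := {i, j, k}) fun m hm => ?_).trans Finset.card_le_three)
    simp only [Finset.mem_insert, Finset.mem_singleton, not_or] at hm
    simp [e, hm.1, hm.2.1, hm.2.2]

lemma exists_hexacode (hu : ResidualWords u) (hij : i ≠ j) (hik : i ≠ k) (hjk : j ≠ k)
    (h0 : hermInner (u i) (u j) + hermInner (u i) (u k) + hermInner (u j) (u k) = 0) :
    ∃ c π, c ^ 2 = c + 1 ∧ ∀ m ∈ ({i, j, k} : Finset (Fin 5)), ∀ l ∈ ({i, j, k} : Finset (Fin 5)),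
      u m + u l ∈ hexacode c π := by
  let D := Submodule.span F4 {(fun _ => 1), u i + u j, u i + u k}
  have hsub : {(fun _ => 1), u i + u j, u i + u k} ⊆ (D : Set (Fin 6 → F4)) :=
    Submodule.subset_span
  simp only [Set.insert_subset_iff, Set.singleton_subset_iff, SetLike.mem_coe] at hsub
  obtain ⟨hone, hj, hk⟩ := hsub
  have hmem : ∀ m ∈ ({i, j, k} : Finset (Fin 5)), u i + u m ∈ D := by
    simp only [Finset.forall_mem_insert, Finset.mem_singleton, forall_eq]
    exact ⟨by simp [← two_smul F4, two_eq_zero], hj, hk⟩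
  have hdim := hu.card_le_finrank hone hmem
  rw [Finset.card_eq_three.2 ⟨i, j, k, hij, hik, hjk, rfl⟩] at hdim
  have hform (z : Fin 6 → F4) (hz : z ∈ D) : ∃ a b c : F4,
      z = (fun _ => a) + (b • (u i + u j) + c • (u i + u k)) := by
    obtain ⟨a, b, c, rfl⟩ := Submodule.mem_span_triple.1 hz
    exact ⟨a, b, c, by rw [add_assoc]; congr 1; ext; simp⟩
  have hsum (z : Fin 6 → F4) (hz : z ∈ D) : ∑ p, z p = 0 := by
    obtain ⟨a, b, c, rfl⟩ := hform z hz
    simp only [Pi.add_apply, Pi.smul_apply, smul_eq_mul, Finset.sum_add_distrib,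
      ← Finset.mul_sum, hu.sum_eq_zero]
    have hsix : (6 : F4) = 0 := mod_cast (natCast_F4_eq_zero_iff 6).2 (by decide)
    simp [hsix]
  have hbal (z : Fin 6 → F4) (hz : z ∈ D) (hconst : ∀ a, z ≠ fun _ => a) : Balanced z := by
    obtain ⟨a, b, c, rfl⟩ := hform z hz
    intro d
    have hfibre : fibre ((fun _ => a) + (b • (u i + u j) + c • (u i + u k))) d =
        fibre (b • (u i + u j) + c • (u i + u k)) (d - a) := by
      ext m
      rw [mem_fibre, mem_fibre, eq_sub_iff_add_eq', Pi.add_apply (fun _ => a)]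
    rw [hfibre]
    exact hu.balanced_smul_add_smul hij hik h0 (fun h => hconst a (by rw [h, add_zero])) _
  obtain ⟨c, π, hc, hD⟩ := exists_le_hexacode hdim hone hsum hbal
  refine ⟨c, π, hc, fun m hm l hl => hD ?_⟩
  have hadd : u i + u m + (u i + u l) = u m + u l := by
    ext p
    simp only [Pi.add_apply]
    linear_combination u i p * two_eq_zero
  exact hadd ▸ D.add_mem (hmem m hm) (hmem l hl)

lemma exists_hexacode_of_pairSum_eq_zero (hu : ResidualWords u) {T : Finset (Fin 5)}
    (hT : T.card = 3) (h0 : pairSum (fun i j => hermInner (u i) (u j)) T = 0) :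
    ∃ c π, c ^ 2 = c + 1 ∧ ∀ m ∈ T, ∀ l ∈ T, u m + u l ∈ hexacode c π := by
  obtain ⟨i, j, k, hij, hjk, rfl⟩ := exists_lt_lt_eq_of_card_eq_three T hT
  rw [pairSum_triple hij hjk] at h0
  exact hu.exists_hexacode hij.ne (hij.trans hjk).ne hjk.ne h0

lemma one_mem_hexacode (c : F4) (π : Equiv.Perm (Fin 3)) : (fun _ => 1) ∈ hexacode c π := by
  refine mem_hexacode.2 fun j => ?_
  rw [Fin.sum_univ_three]
  linear_combination (-2 * c) * two_eq_zero

lemma card_le_three_of_add_mem_hexacode (hu : ResidualWords u) {S : Finset (Fin 5)}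
    (hS : ∀ m ∈ S, u i + u m ∈ hexacode c π) : S.card ≤ 3 :=
  (hu.card_le_finrank (one_mem_hexacode c π) hS).trans (finrank_hexacode_le c π)

lemma even_card_zeroTriples (hu : ResidualWords u) :
    Even (zeroTriples fun i j => hermInner (u i) (u j)).card := by
  choose! c π hc hmem using fun (T : Finset (Fin 5))
      (hT : T ∈ zeroTriples fun i j => hermInner (u i) (u j)) =>
    hu.exists_hexacode_of_pairSum_eq_zero (mem_zeroTriples.1 hT).1 (mem_zeroTriples.1 hT).2
  refine even_card_of_forall_even_card (fun T hT => (mem_zeroTriples.1 hT).1)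
    (fun T => hexacodeColour (c T) (π T)) (fun T hT T' hT' hne hinter => ?_)
    (even_card_zeroTriples_avoiding hu.isIdempotentElem_hermInner)
  obtain ⟨i, hi, j, hj, hij⟩ := Finset.one_lt_card.1 hinter
  rw [Finset.mem_inter] at hi hj
  refine not_hexacodeColour_iff (hc T hT) (hc T' hT') (hmem T hT i hi.1 j hj.1)
    (hmem T' hT' i hi.2 j hj.2) (hu.add_ne_const hij) fun heq => hne ?_
  obtain ⟨hcc, hππ⟩ := Prod.mk.inj heq
  have hunion : (T ∪ T').card ≤ 3 := by
    refine hu.card_le_three_of_add_mem_hexacode (i := i) (c := c T) (π := π T) fun m hm => ?_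
    obtain hm | hm := Finset.mem_union.1 hm
    · exact hmem T hT i hi.1 m hm
    · rw [hcc, hππ]
      exact hmem T' hT' i hi.2 m hm
  exact (Finset.eq_of_subset_of_card_le Finset.subset_union_left
    (hunion.trans_eq (mem_zeroTriples.1 hT).1.symm)).trans
    (Finset.eq_of_subset_of_card_le Finset.subset_union_right
      (hunion.trans_eq (mem_zeroTriples.1 hT').1.symm)).symm

lemma hermInner_linearCombination (b : Fin 5 → F4) (v : Fin 6 → F4) :
    hermInner (Fintype.linearCombination F4 u b) v = ∑ m, b m * hermInner (u m) v := by
  simp only [Fintype.linearCombination_apply, hermInner, Finset.sum_apply, Pi.smul_apply,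
    smul_eq_mul, Finset.sum_mul, Finset.mul_sum, mul_assoc]
  exact Finset.sum_comm

/-- The all-one word and the words `u 0 + u m` span a hyperplane whose dual contains only constant
words. -/
lemma eq_zero_of_hermInner_eq_zero (hu : ResidualWords u) {b : Fin 5 → F4} (hsum : ∑ i, b i = 0)
    (h0 : ∀ m, hermInner (Fintype.linearCombination F4 u b) (u m) = 0) : b = 0 := by
  by_contra hne
  let y := Fintype.linearCombination F4 u b
  let one : Fin 6 → F4 := fun _ => 1
  let W := Submodule.span F4 (Set.range fun m => if m = 0 then one else u 0 + u m)
  have hW : Module.finrank F4 W = 5 := finrank_span_eq_card (hu.linearIndependent 0)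
  have mem_dual {v : Fin 6 → F4} (hv1 : hermInner one v = 0) (hv : ∀ m, hermInner (u m) v = 0) :
      v ∈ hermDual W := by
    refine mem_hermDual_span.2 ?_
    rintro _ ⟨m, rfl⟩
    dsimp only
    split_ifs
    · exact hv1
    · rw [hermInner_add_left, hv, hv, add_zero]
  have hone : one ∈ hermDual W := by
    refine mem_dual ?_ fun m => ?_
    · rw [Quaternary.hermInner_self, natCast_F4_eq_zero_iff]
      have hnorm : hammingNorm one = 6 := by simp [one, hammingNorm]
      rw [hnorm]
      decide
    · simpa [hermInner, one] using hu.sum_eq_zero m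
  have hy : y ∈ hermDual W := by
    refine mem_dual (hermInner_comm_eq_zero ?_) fun m => hermInner_comm_eq_zero (h0 m)
    simpa [hermInner, one] using hu.sum_linearCombination b
  have hdual := finrank_hermDual_add_finrank W
  obtain ⟨a, ha⟩ := (finrank_eq_one_iff_of_nonzero' (K := F4) (⟨one, hone⟩ : hermDual W)
    fun h => one_ne_zero (congrFun (congrArg Subtype.val h) 0)).1 (by omega) ⟨y, hy⟩
  refine hu.linearCombination_ne_const hne hsum a ?_
  exact (congrArg Subtype.val ha).symm.trans (funext fun _ => mul_one a)

/-- The Gram matrix of `u 1, …, u 4`, with `s` added off the diagonal. -/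
noncomputable def gramAdd (u : Fin 5 → Fin 6 → F4) (s : F4) : Matrix (Fin 4) (Fin 4) F4 :=
  .of fun i j => hermInner (u i.succ) (u j.succ) + s + if i = j then s else 0

lemma det_gramAdd_ne_zero (hu : ResidualWords u) {s : F4} (hnondeg : ∀ b, ∑ i, b i = 0 →
    (∀ m, s * (b 0 + b m) + hermInner (Fintype.linearCombination F4 u b) (u m) = 0) → b = 0) :
    (gramAdd u s).det ≠ 0 := by
  intro hdet
  obtain ⟨x, hx, hxA⟩ := Matrix.exists_vecMul_eq_zero_iff.2 hdet
  have hsum : ∑ m : Fin 5, (Fin.cons (∑ i, x i) x : Fin 5 → F4) m = 0 := by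
    rw [Fin.sum_cons, CharTwo.add_self_eq_zero]
  refine hx (funext fun i => congrFun (hnondeg (Fin.cons (∑ i, x i) x) hsum fun m => ?_) i.succ)
  rw [hermInner_linearCombination, Fin.sum_univ_succ (n := 4), hu.zero, Fin.cons_zero]
  simp only [Fin.cons_succ, hermInner_zero_left, mul_zero, zero_add]
  refine Fin.cases ?_ (fun j => ?_) m
  · simp [hermInner, hu.zero, CharTwo.add_self_eq_zero]
  · refine Eq.trans ?_ (congrFun hxA j)
    simp only [Matrix.vecMul, dotProduct, gramAdd, Matrix.of_apply, mul_add,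
      Finset.sum_add_distrib, mul_ite, mul_zero, Finset.sum_ite_eq', Finset.mem_univ, if_true,
      Fin.cons_succ, ← Finset.sum_mul]
    ring

/-- The determinant of an alternating matrix is the square of its Pfaffian, which here lies in the
prime field. -/
lemma pfaffian_gramAdd_eq_one (hu : ResidualWords u) {s : F4} (hs : IsIdempotentElem s)
    (hnondeg : ∀ b, ∑ i, b i = 0 →
      (∀ m, s * (b 0 + b m) + hermInner (Fintype.linearCombination F4 u b) (u m) = 0) → b = 0) :
    (hermInner (u 1) (u 2) + s) * (hermInner (u 3) (u 4) + s) +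
      (hermInner (u 1) (u 3) + s) * (hermInner (u 2) (u 4) + s) +
      (hermInner (u 1) (u 4) + s) * (hermInner (u 2) (u 3) + s) = 1 := by
  have hdet := hu.det_gramAdd_ne_zero hnondeg
  have h (i j) : IsIdempotentElem (hermInner (u i) (u j) + s) :=
    isIdempotentElem_add (hu.isIdempotentElem_hermInner i j) hs
  refine (IsIdempotentElem.iff_eq_zero_or_one.1 (isIdempotentElem_add (isIdempotentElem_add
    ((h _ _).mul (h _ _)) ((h _ _).mul (h _ _))) ((h _ _).mul (h _ _)))).resolve_left
    fun h0 => hdet ?_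
  rw [det_fin_four_eq_sq _ (fun i => ?_) fun i j => ?_, CharTwo.sub_eq_add]
  · simpa [gramAdd] using h0
  · simp [gramAdd, hu.hermInner_self, CharTwo.add_self_eq_zero]
  · simp only [gramAdd, Matrix.of_apply, hu.hermInner_comm i.succ j.succ, eq_comm (a := j),
      CharTwo.neg_eq]

end ResidualWords

/-- The two Pfaffians of `pfaffian_gramAdd_eq_one` for `s = 0` and `s = 1` differ by the sum of all
products `hermInner (u i) (u j)`, whose parity is that of the number of zero triples. -/
lemma not_residualWords (u : Fin 5 → Fin 6 → F4) : ¬ResidualWords u := by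
  intro hu
  have h0 := hu.pfaffian_gramAdd_eq_one (s := 0) .zero fun b hsum h =>
    hu.eq_zero_of_hermInner_eq_zero hsum (by simpa using h)
  have h1 := hu.pfaffian_gramAdd_eq_one (s := 1) .one fun b hsum h =>
    hu.nondegenerate b hsum (by simpa using h)
  have hcard := natCast_card_zeroTriples hu.isIdempotentElem_hermInner
  rw [(natCast_F4_eq_zero_iff _).2 hu.even_card_zeroTriples] at hcard
  rw [Finset.sum_filter, Fintype.sum_prod_type] at hcard
  simp only [Fin.sum_univ_five, hu.zero, hermInner_zero_left, ite_self, zero_add, add_zero,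
    Fin.reduceLT, if_true, if_false] at hcard
  exact one_ne_zero (α := F4) (by linear_combination h1 - h0 + hcard - two_eq_zero)

section ResidualCode

variable {n p q : ℕ} {C : Submodule F4 (Fin n → F4)} {h : Fin n → F4}

/-- The restriction of a word to the zeros of `h`, enumerated by `z`. -/
noncomputable def onZeros (z : Fin p ≃ {i // h i = 0}) : (Fin n → F4) →ₗ[F4] (Fin p → F4) :=
  LinearMap.funLeft F4 F4 fun j => (z j : Fin n)

/-- The restriction of a word to the support of `h`, enumerated by `e`, with the coordinates scaled
so that `h` itself becomes the all-one word. -/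
noncomputable def onSupport (e : Fin q ≃ {i // ¬h i = 0}) : (Fin n → F4) →ₗ[F4] (Fin q → F4) :=
  LinearMap.pi fun j => (h (e j))⁻¹ • LinearMap.proj (e j : Fin n)

variable (z : Fin p ≃ {i // h i = 0}) (e : Fin q ≃ {i // ¬h i = 0})

lemma onZeros_apply (w : Fin n → F4) (j : Fin p) : onZeros z w j = w (z j) := rfl

lemma onSupport_apply (w : Fin n → F4) (j : Fin q) : onSupport e w j = (h (e j))⁻¹ * w (e j) := rfl

lemma onZeros_self : onZeros z h = 0 :=
  funext fun j => (z j).2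

lemma onSupport_self : onSupport e h = fun _ => 1 :=
  funext fun j => inv_mul_cancel₀ (e j).2

lemma sum_eq_sum_zeros_add_sum_support {M : Type*} [AddCommMonoid M] (f : Fin n → M) :
    ∑ i, f i = ∑ j, f (z j) + ∑ j, f (e j) := by
  rw [← Fintype.sum_subtype_add_sum_subtype (fun i => h i = 0), ← Equiv.sum_comp z,
    ← Equiv.sum_comp e]

lemma hermInner_eq_onZeros_add_onSupport (v w : Fin n → F4) :
    hermInner v w = hermInner (onZeros z v) (onZeros z w) +
      hermInner (onSupport e v) (onSupport e w) := by
  simp only [hermInner, sum_eq_sum_zeros_add_sum_support z e, onZeros_apply, onSupport_apply]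
  congr 1
  refine Finset.sum_congr rfl fun j _ => ?_
  have hj := (e j).2
  have h3 := pow_three_eq_one hj
  field_simp
  rw [h3, mul_one]

lemma hammingNorm_eq_onZeros_add_onSupport (w : Fin n → F4) :
    hammingNorm w = hammingNorm (onZeros z w) + hammingNorm (onSupport e w) := by
  simp only [hammingNorm, Finset.card_filter]
  rw [sum_eq_sum_zeros_add_sum_support z e]
  refine congrArg _ (Finset.sum_congr rfl fun j _ => if_congr ?_ rfl rfl)
  rw [onSupport_apply, mul_ne_zero_iff, and_iff_right (inv_ne_zero (e j).2)]

lemma sum_onSupport (w : Fin n → F4) : ∑ j, onSupport e w j = hermInner w h := by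
  let z := (Fintype.equivFin {i // h i = 0}).symm
  rw [hermInner_eq_onZeros_add_onSupport z e, onZeros_self, onSupport_self]
  simp [hermInner]

variable {z e}

lemma eq_neg_smul_or_le (hd : MinDistGE C q) (hh : h ∈ C) {c : Fin n → F4} (hc : c ∈ C) (a : F4) :
    c = -a • h ∨ (fibre (onSupport e c) a).card ≤ hammingNorm (onZeros z c) := by
  refine or_iff_not_imp_left.2 fun hne => ?_
  have hle := hd (c + a • h) (C.add_mem hc (C.smul_mem a hh)) fun h0 =>
    hne (by rw [eq_neg_of_add_eq_zero_left h0, neg_smul])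
  have hone : a • (fun _ => 1 : Fin q → F4) = fun _ => a := funext fun _ => mul_one a
  rw [hammingNorm_eq_onZeros_add_onSupport z e, map_add, map_add, map_smul, map_smul,
    onZeros_self, onSupport_self, smul_zero, add_zero, hone] at hle
  have hsplit := card_fibre_add_hammingNorm (onSupport e c) a
  omega

lemma card_fibre_onSupport_le (hd : MinDistGE C q) (hh : h ∈ C) {c : Fin n → F4} (hc : c ∈ C)
    (hne : onZeros z c ≠ 0) (a : F4) :
    (fibre (onSupport e c) a).card ≤ hammingNorm (onZeros z c) := by
  refine (eq_neg_smul_or_le hd hh hc a).resolve_left fun hca => hne ?_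
  rw [hca, map_smul, onZeros_self, smul_zero]

lemma mem_span_of_hammingNorm_onZeros_le_one (hq : 4 < q) (hd : MinDistGE C q) (hh : h ∈ C)
    (e : Fin q ≃ {i // ¬h i = 0}) {c : Fin n → F4} (hc : c ∈ C)
    (hle : hammingNorm (onZeros z c) ≤ 1) : c ∈ Submodule.span F4 {h} := by
  let _ := Fintype.ofFinite F4
  obtain ⟨a, ha⟩ := Fintype.exists_lt_card_fiber_of_mul_lt_card (f := onSupport e c) (n := 1)
    (by rwa [Fintype.card_eq_nat_card (α := F4), natCard_F4, Fintype.card_fin])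
  obtain hca | hca := eq_neg_smul_or_le (z := z) (e := e) hd hh hc a
  · exact Submodule.mem_span_singleton.2 ⟨_, hca.symm⟩
  · exact absurd (ha.trans_le hca) (not_lt.2 hle)

variable {z : Fin 5 ≃ {i // h i = 0}} {e : Fin 6 ≃ {i // ¬h i = 0}}

lemma exists_onZeros_eq (hd : MinDistGE C 6) (hh : h ∈ C) (hn : n = 11)
    (hdim : Module.finrank F4 C = 5) (e : Fin 6 ≃ {i // ¬h i = 0}) (m : Fin 4) :
    ∃ c ∈ C, ∃ α ≠ 0, onZeros z c = Pi.single 0 1 + Pi.single m.succ α := by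
  let T : Finset (Fin n) := Finset.univ.image fun j : Fin 4 => (z j.succ : Fin n)
  have hinj : Function.Injective fun j : Fin 4 => (z j.succ : Fin n) :=
    Subtype.val_injective.comp (z.injective.comp (Fin.succ_injective 4))
  have hT : T.card = 4 := Finset.card_image_of_injective _ hinj
  obtain ⟨c, hc, hm, hj⟩ := exists_mem_eq_single supportedOn_univ hd (Finset.subset_univ T)
    (by omega) (by
      rw [hT, hdim, Finset.card_univ, Fintype.card_fin, hn]
      exact .of_plotkin two_ne_zero (by rw [natCard_F4]; decide))
    (Finset.mem_image_of_mem _ (Finset.mem_univ m))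
  have hz : onZeros z c = Pi.single 0 (c (z 0)) + Pi.single m.succ (c (z m.succ)) := by
    refine funext fun j => Fin.cases ?_ (fun j => ?_) j
    · simp [onZeros_apply]
    · obtain rfl | hjm := eq_or_ne j m
      · simp [onZeros_apply]
      · simp [onZeros_apply, hjm,
          hj _ (Finset.mem_image_of_mem _ (Finset.mem_univ j)) (hinj.ne hjm)]
  have h0 : c (z 0) ≠ 0 := by
    intro h0
    have hspan := mem_span_of_hammingNorm_onZeros_le_one (z := z) (by decide) hd hh e hc (by
      rw [hz, h0, Pi.single_zero, zero_add]
      refine (hammingNorm_le_card_of_support (S := {m.succ}) fun i hi => ?_).trans_eq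
        (Finset.card_singleton _)
      exact Pi.single_eq_of_ne (by simpa using hi) _)
    obtain ⟨a, rfl⟩ := Submodule.mem_span_singleton.1 hspan
    exact hm (by simp [(z m.succ).2])
  refine ⟨(c (z 0))⁻¹ • c, C.smul_mem _ hc, _, mul_ne_zero (inv_ne_zero h0) hm, ?_⟩
  rw [map_smul, hz, smul_add, ← Pi.single_smul, ← Pi.single_smul, smul_eq_mul, smul_eq_mul,
    inv_mul_cancel₀ h0]

variable {c : Fin 4 → Fin n → F4} {α : Fin 4 → F4}

lemma onZeros_sum_smul (hz : ∀ m, onZeros z (c m) = Pi.single 0 1 + Pi.single m.succ (α m))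
    {b : Fin 5 → F4} (hb : ∑ i, b i = 0) :
    onZeros z (∑ m, b m.succ • c m) = fun i => (Fin.cons 1 α : Fin 5 → F4) i * b i := by
  rw [Fin.sum_univ_succ, CharTwo.add_eq_zero] at hb
  refine funext fun i => ?_
  simp only [map_sum, map_smul, hz, Finset.sum_apply, Pi.smul_apply, Pi.add_apply, smul_eq_mul]
  refine Fin.cases ?_ (fun j => ?_) i
  · simp [hb]
  · simp [Pi.single_apply, mul_comm]

lemma hermInner_sum_smul (hα : ∀ m, α m ≠ 0)
    (hz : ∀ m, onZeros z (c m) = Pi.single 0 1 + Pi.single m.succ (α m))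
    {b : Fin 5 → F4} (hb : ∑ i, b i = 0) (m : Fin 4) :
    hermInner (∑ m, b m.succ • c m) (c m) =
      b 0 + b m.succ + hermInner (onSupport e (∑ m, b m.succ • c m)) (onSupport e (c m)) := by
  rw [hermInner_eq_onZeros_add_onSupport z e, onZeros_sum_smul hz hb, hz, hermInner_add_right,
    hermInner_single_right, hermInner_single_right]
  simp only [Fin.cons_zero, Fin.cons_succ]
  linear_combination b m.succ * pow_three_eq_one (hα m)

lemma le_span_insert_range (hd : MinDistGE C 6) (hh : h ∈ C) (e : Fin 6 ≃ {i // ¬h i = 0})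
    (hc : ∀ m, c m ∈ C) (hα : ∀ m, α m ≠ 0)
    (hz : ∀ m, onZeros z (c m) = Pi.single 0 1 + Pi.single m.succ (α m)) :
    C ≤ Submodule.span F4 (insert h (Set.range c)) := by
  intro x hx
  let y := ∑ m, (x (z m.succ) / α m) • c m
  have hy : y ∈ Submodule.span F4 (Set.range c) :=
    Submodule.sum_mem _ fun m _ => Submodule.smul_mem _ _ (Submodule.subset_span ⟨m, rfl⟩)
  have hyC : y ∈ C := C.sum_mem fun m _ => C.smul_mem _ (hc m)
  have hxy : x - y ∈ Submodule.span F4 {h} := by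
    refine mem_span_of_hammingNorm_onZeros_le_one (z := z) (by decide) hd hh e (C.sub_mem hx hyC)
      ((hammingNorm_le_card_of_support (S := {0}) fun i hi => ?_).trans_eq
        (Finset.card_singleton _))
    obtain ⟨j, rfl⟩ := Fin.exists_succ_eq.2 (Finset.notMem_singleton.1 hi)
    have hj : onZeros z x j.succ = x (z j.succ) := rfl
    simp [y, hz, Pi.single_apply, hα, hj]
  rw [← sub_add_cancel x y]
  exact add_mem (Submodule.span_mono (by simp) hxy) (Submodule.span_mono (Set.subset_insert _ _) hy)

lemma exists_residualWords (hd : MinDistGE C 6) (hn : n = 11) (hdim : Module.finrank F4 C = 5)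
    (hh : hermHull C = Submodule.span F4 {h}) (z : Fin 5 ≃ {i // h i = 0})
    (e : Fin 6 ≃ {i // ¬h i = 0}) : ∃ u, ResidualWords u := by
  have hhull : h ∈ hermHull C := hh ▸ Submodule.mem_span_singleton_self h
  choose c hc α hα hz using exists_onZeros_eq (z := z) hd hhull.1 hn hdim e
  refine ⟨Fin.cons 0 fun m => onSupport e (c m), ?_⟩
  let word (b : Fin 5 → F4) : Fin n → F4 := ∑ m, b m.succ • c m
  have hword (b) : word b ∈ C := C.sum_mem fun m _ => C.smul_mem _ (hc m)
  have hsupp (b) : onSupport e (word b) = Fintype.linearCombination F4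
      (Fin.cons 0 fun m => onSupport e (c m) : Fin 5 → Fin 6 → F4) b := by
    simp [word, Fintype.linearCombination_apply, Fin.sum_univ_succ (n := 4)]
  have hnorm {b : Fin 5 → F4} (hb : ∑ i, b i = 0) :
      hammingNorm (onZeros z (word b)) = hammingNorm b := by
    rw [onZeros_sum_smul hz hb]
    exact hammingNorm_comp (fun i x => (Fin.cons 1 α : Fin 5 → F4) i * x)
      (fun i => mul_right_injective₀ (Fin.cases one_ne_zero hα i)) fun i => mul_zero _
  refine ⟨rfl, fun i => ?_, fun b hb hsum a => ?_, fun b hsum horth => ?_⟩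
  · refine Fin.cases (Finset.sum_const_zero) (fun m => ?_) i
    exact (sum_onSupport e (c m)).trans (hhull.2 _ (hc m))
  · rw [← hsupp, ← hnorm hsum]
    refine card_fibre_onSupport_le hd hhull.1 (hword b) ?_ a
    rwa [← hammingNorm_ne_zero_iff, hnorm hsum, hammingNorm_ne_zero_iff]
  · have hdual : word b ∈ hermDual C := by
      have hspan : word b ∈ hermDual (Submodule.span F4 (insert h (Set.range c))) := by
        rw [mem_hermDual_span, Set.forall_mem_insert, Set.forall_mem_range]
        refine ⟨hermInner_comm_eq_zero (hhull.2 _ (hword b)), fun m => hermInner_comm_eq_zero ?_⟩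
        rw [hermInner_sum_smul (e := e) hα hz hsum m, hsupp]
        exact horth m.succ
      exact fun x hx => hspan x (le_span_insert_range hd hhull.1 e hc hα hz hx)
    have hmem : word b ∈ hermHull C := ⟨hword b, hdual⟩
    rw [hh] at hmem
    obtain ⟨a, ha⟩ := Submodule.mem_span_singleton.1 hmem
    rw [← hammingNorm_eq_zero, ← hnorm hsum, ← ha, map_smul, onZeros_self, smul_zero,
      hammingNorm_zero]

lemma not_minDistGE_six_of_11_5 (hn : n = 11) (hdim : Module.finrank F4 C = 5)
    (hl : Module.finrank F4 (hermHull C) = 1) : ¬MinDistGE C 6 := by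
  intro hd
  obtain ⟨h, h0, hh⟩ := exists_hermHull_eq_span hl
  have hsix := hammingNorm_eq_six_of_11_5_6 supportedOn_univ hd (by simpa using hn) hdim h0 hh
  have hcard : Fintype.card {i // ¬h i = 0} = 6 := by
    rw [Fintype.card_subtype]
    exact hsix
  have hzeros : Fintype.card {i // h i = 0} = 5 := by
    have hcompl := Fintype.card_subtype_compl fun i => h i = 0
    have hle := Fintype.card_subtype_le fun i => h i = 0
    rw [Fintype.card_fin] at hcompl hle
    omega
  obtain ⟨u, hu⟩ := exists_residualWords hd hn hdim hh (Fintype.equivFinOfCardEq hzeros).symm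
    (Fintype.equivFinOfCardEq hcard).symm
  exact not_residualWords u hu

end ResidualCode

section UpperBounds

variable {n k : ℕ} {C : Submodule F4 (Fin n → F4)}

lemma not_minDistGE_five_of_11_6 (hn : n = 11) (hdim : Module.finrank F4 C = 6)
    (hl : Module.finrank F4 (hermHull C) = 1) : ¬MinDistGE C 5 := by
  subst hn
  intro hd
  have hdual := finrank_hermDual_add_finrank C
  rw [hdim] at hdual
  refine not_minDistGE_six_of_11_5 rfl (by omega : Module.finrank F4 (hermDual C) = 5)
    (by rwa [hermHull_hermDual]) fun c hc => ?_
  refine hd.shorten_hermDual (e := 5) supportedOn_univ (by omega) (fun t ht => ?_) c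
    (mem_shorten.2 ⟨hc, by simp⟩)
  rw [hdim, Finset.card_univ, Fintype.card_fin]
  exact .of_excluded_sporadic (by interval_cases t <;> decide)

/-- The parameters for which the bound of the table needs the weight distribution of the code. -/
def exceptional : List (ℕ × ℕ) :=
  [(5, 2), (5, 3), (6, 3), (8, 2), (10, 2), (10, 4), (11, 5), (11, 6)]

lemma not_minDistGE_of_mem_exceptional (hmem : (n, k) ∈ exceptional)
    (hdim : Module.finrank F4 C = k) (hl : Module.finrank F4 (hermHull C) = 1) :
    ¬MinDistGE C (tableEntry n k + 1) := by
  intro hd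
  have hA := hd.hullWeightConstraints supportedOn_univ
  rw [hdim, hl, Finset.card_univ, Fintype.card_fin] at hA
  simp only [exceptional, List.mem_cons, Prod.mk.injEq, List.not_mem_nil, or_false] at hmem
  rcases hmem with ⟨rfl, rfl⟩ | ⟨rfl, rfl⟩ | ⟨rfl, rfl⟩ | ⟨rfl, rfl⟩ | ⟨rfl, rfl⟩ | ⟨rfl, rfl⟩ |
    ⟨rfl, rfl⟩ | ⟨rfl, rfl⟩
  · exact hA.not_5_2_1_4
  · exact hA.not_5_3_1_3
  · exact hA.not_6_3_1_4
  · exact hA.not_8_2_1_6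
  · exact hA.not_10_2_1_8
  · exact finrank_hermHull_ne_one_of_10_4_6 supportedOn_univ hd (by simp) hdim hl
  · exact not_minDistGE_six_of_11_5 rfl hdim hl hd
  · exact not_minDistGE_five_of_11_6 rfl hdim hl hd

lemma excluded_or_odd_or_mem_exceptional : ∀ n ∈ Finset.range 13, ∀ k ∈ Finset.Ico 1 n,
    excluded sporadic n k (tableEntry n k + 1) = true ∨
      Odd n ∧ tableEntry n k + 1 = n ∨
      Odd n ∧ k + 1 = n ∧ tableEntry n k + 1 = 2 ∨ (n, k) ∈ exceptional := by
  decide +kernel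

lemma not_minDistGE_tableEntry_add_one (hk : 1 ≤ k) (hkn : k < n) (hn : n ≤ 12)
    (hdim : Module.finrank F4 C = k) (hl : Module.finrank F4 (hermHull C) = 1) :
    ¬MinDistGE C (tableEntry n k + 1) := by
  intro hd
  rcases excluded_or_odd_or_mem_exceptional n (Finset.mem_range.2 (by omega)) k
      (Finset.mem_Ico.2 ⟨hk, hkn⟩) with
    hex | ⟨hodd, he⟩ | ⟨hodd, hk1, he⟩ | hmem
  · exact (NoCode.of_excluded_sporadic hex (by simp) supportedOn_univ hd).ne hdim
  · exact finrank_hermHull_ne_one_of_odd_of_minDistGE hodd (by rwa [he] at hd) hl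
  · exact finrank_hermHull_ne_one_of_finrank_add_one_eq hodd (by omega) (by rwa [he] at hd) hl
  · exact not_minDistGE_of_mem_exceptional hmem hdim hl hd

end UpperBounds

section OrthogonalBasis

variable {n : ℕ} {C : Submodule F4 (Fin n → F4)} {ι : Type*} [Fintype ι] {e : ι → Fin n → F4}

lemma hermInner_sum_smul_of_pairwise (horth : Pairwise fun i j => hermInner (e i) (e j) = 0)
    (a : ι → F4) (j : ι) : hermInner (∑ i, a i • e i) (e j) = a j * hermInner (e j) (e j) := by
  have hsum : hermInner (∑ i, a i • e i) (e j) = ∑ i, a i * hermInner (e i) (e j) := by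
    simp only [hermInner, Finset.sum_apply, Pi.smul_apply, smul_eq_mul, Finset.sum_mul,
      Finset.mul_sum, mul_assoc]
    exact Finset.sum_comm
  rw [hsum, Fintype.sum_eq_single j fun i hi => by rw [horth hi, mul_zero]]

lemma sum_smul_eq_of_mul_hermInner_self_eq_zero {i₀ : ι}
    (hnon : ∀ i ≠ i₀, hermInner (e i) (e i) ≠ 0)
    {a : ι → F4} (ha : ∀ i, a i * hermInner (e i) (e i) = 0) :
    ∑ i, a i • e i = a i₀ • e i₀ :=
  Fintype.sum_eq_single i₀ fun i hi => by
    rw [(mul_eq_zero.1 (ha i)).resolve_right (hnon i hi), zero_smul]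

lemma linearIndependent_of_pairwise_hermInner {ι : Type*} [Finite ι] {e : ι → Fin n → F4} {i₀ : ι}
    (horth : Pairwise fun i j => hermInner (e i) (e j) = 0) (h0 : e i₀ ≠ 0)
    (hnon : ∀ i ≠ i₀, hermInner (e i) (e i) ≠ 0) : LinearIndependent F4 e := by
  let _ := Fintype.ofFinite ι
  rw [Fintype.linearIndependent_iff]
  intro a hsum
  have ha : ∀ i, a i * hermInner (e i) (e i) = 0 := fun i => by
    rw [← hermInner_sum_smul_of_pairwise horth, hsum, hermInner_zero_left]
  rw [sum_smul_eq_of_mul_hermInner_self_eq_zero hnon ha, smul_eq_zero_iff_left h0] at hsum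
  intro i
  obtain rfl | hi := eq_or_ne i i₀
  · exact hsum
  · exact (mul_eq_zero.1 (ha i)).resolve_right (hnon i hi)

lemma finrank_hermHull_eq_one {i₀ : ι} (hC : ∀ i, e i ∈ C)
    (hcard : Module.finrank F4 C = Fintype.card ι)
    (horth : Pairwise fun i j => hermInner (e i) (e j) = 0) (h0 : e i₀ ≠ 0)
    (hiso : hermInner (e i₀) (e i₀) = 0) (hnon : ∀ i ≠ i₀, hermInner (e i) (e i) ≠ 0) :
    Module.finrank F4 (hermHull C) = 1 := by
  have hspan : Submodule.span F4 (Set.range e) = C :=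
    Submodule.eq_of_le_of_finrank_eq (Submodule.span_le.2 (Set.range_subset_iff.2 hC)) <| by
      rw [finrank_span_eq_card (linearIndependent_of_pairwise_hermInner horth h0 hnon), hcard]
  have hrep : ∀ v ∈ C, ∃ a : ι → F4, ∑ i, a i • e i = v := fun v hv => by
    rwa [← hspan, Submodule.mem_span_range_iff_exists_fun] at hv
  suffices hermHull C = Submodule.span F4 {e i₀} by rw [this, finrank_span_singleton h0]
  refine le_antisymm (fun v hv => ?_) ?_
  · obtain ⟨a, rfl⟩ := hrep v hv.1
    rw [sum_smul_eq_of_mul_hermInner_self_eq_zero hnon fun i => ?_]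
    · exact Submodule.smul_mem _ _ (Submodule.mem_span_singleton_self _)
    · rw [← hermInner_sum_smul_of_pairwise horth]
      exact hermInner_comm_eq_zero (hv.2 _ (hC i))
  · refine (Submodule.span_singleton_le_iff_mem _ _).2 ⟨hC i₀, fun u hu => ?_⟩
    obtain ⟨a, rfl⟩ := hrep u hu
    rw [hermInner_sum_smul_of_pairwise horth, hiso, mul_zero]

lemma hermInner_eq_zero_of_even {u v : Fin n → F4}
    (h₁ : Even (hammingNorm u + hammingNorm v + hammingNorm (u + v)))
    (hω : Even (hammingNorm u + hammingNorm v + hammingNorm (ω • u + v))) :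
    hermInner u v = 0 := by
  have hnorm : hammingNorm (ω • u) = hammingNorm u :=
    hammingNorm_smul (fun _ => smul_right_injective F4 ω_ne_zero) u
  rw [← natCast_F4_eq_zero_iff] at h₁ hω
  push_cast [natCast_hammingNorm_add, hnorm, hermInner_smul_left, tr] at h₁ hω
  linear_combination ω ^ 2 * h₁ - hω - hermInner u v * ω_sq -
    (hammingNorm u + hammingNorm v) * (ω ^ 2 - 1) * two_eq_zero

end OrthogonalBasis

section BitMasks

variable {n : ℕ} {C : Submodule F4 (Fin n → F4)} {p q r : ℕ × ℕ}

/-- The number of ones among the lowest `m` binary digits of `x`. -/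
def popCount : ℕ → ℕ → ℕ
  | 0, _ => 0
  | m + 1, x => x % 2 + popCount m (x / 2)

/-- A bit as an element of the field. -/
noncomputable def bit (b : Bool) : F4 := if b then 1 else 0

/-- The vector coded by a pair of bit masks, with `i`-th coordinate `s + t ω` for the `i`-th bits
`s` and `t` of the two masks. -/
noncomputable def decode (n : ℕ) (p : ℕ × ℕ) : Fin n → F4 :=
  fun i => bit (p.1.testBit i) + bit (p.2.testBit i) * ω

/-- The sum of vectors, in the coding by bit masks. -/
def addMasks (p q : ℕ × ℕ) : ℕ × ℕ := (p.1 ^^^ q.1, p.2 ^^^ q.2)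

/-- The multiple of a vector by `ω`, in the coding by bit masks. -/
def omegaMasks (p : ℕ × ℕ) : ℕ × ℕ := (p.2, p.1 ^^^ p.2)

/-- The multiples of a vector by the nonzero scalars, in the coding by bit masks. -/
def multiples (p : ℕ × ℕ) : List (ℕ × ℕ) := [p, omegaMasks p, addMasks (omegaMasks p) p]

/-- The Hamming weight, in the coding by bit masks. -/
def maskWeight (n : ℕ) (p : ℕ × ℕ) : ℕ := popCount n (p.1 ||| p.2)

lemma popCount_eq_sum (m x : ℕ) : popCount m x = ∑ i : Fin m, if x.testBit i then 1 else 0 := by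
  induction m generalizing x with
  | zero => rfl
  | succ m ih =>
    rw [popCount, ih, Fin.sum_univ_succ]
    congr 1
    · rcases Nat.mod_two_eq_zero_or_one x with h | h <;> simp [Nat.testBit_zero, h]
    · simp [Nat.testBit_succ]

lemma bit_xor (a b : Bool) : bit (a ^^ b) = bit a + bit b := by
  cases a <;> cases b <;> simp [bit, one_add_one_eq_two, two_eq_zero]

lemma bit_add_bit_mul_ne_zero {a b : Bool} : bit a + bit b * ω ≠ 0 ↔ (a || b) = true := by
  cases a <;> cases b <;> simp [bit, ω_ne_zero, add_comm (1 : F4) ω, ω_add_one_ne_zero]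

lemma hammingNorm_decode (p : ℕ × ℕ) : hammingNorm (decode n p) = maskWeight n p := by
  simp only [hammingNorm, maskWeight, popCount_eq_sum, Finset.card_filter, decode,
    bit_add_bit_mul_ne_zero, Nat.testBit_or]

lemma decode_zero : decode n (0, 0) = 0 := by
  funext i
  simp [decode, bit]

lemma decode_addMasks (p q : ℕ × ℕ) : decode n (addMasks p q) = decode n p + decode n q := by
  funext i
  simp only [decode, addMasks, Nat.testBit_xor, bit_xor, Pi.add_apply]
  ring

lemma decode_omegaMasks (p : ℕ × ℕ) : decode n (omegaMasks p) = ω • decode n p := by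
  funext i
  simp only [decode, omegaMasks, Nat.testBit_xor, bit_xor, Pi.smul_apply, smul_eq_mul]
  linear_combination -bit (p.2.testBit i) * ω_sq

lemma exists_mem_multiples {a : F4} (ha : a ≠ 0) (p : ℕ × ℕ) :
    ∃ q ∈ multiples p, decode n q = a • decode n p := by
  rcases eq_zero_or_one_or_ω a with rfl | rfl | rfl | rfl
  · exact absurd rfl ha
  · exact ⟨p, by simp [multiples], (one_smul ..).symm⟩
  · exact ⟨omegaMasks p, by simp [multiples], decode_omegaMasks p⟩
  · exact ⟨addMasks (omegaMasks p) p, by simp [multiples], by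
      rw [decode_addMasks, decode_omegaMasks, add_smul, one_smul]⟩

lemma exists_smul_of_mem_multiples (hq : q ∈ multiples p) :
    ∃ a : F4, decode n q = a • decode n p := by
  simp only [multiples, List.mem_cons, List.not_mem_nil, or_false] at hq
  rcases hq with rfl | rfl | rfl
  · exact ⟨1, (one_smul ..).symm⟩
  · exact ⟨ω, decode_omegaMasks p⟩
  · exact ⟨ω + 1, by rw [decode_addMasks, decode_omegaMasks, add_smul, one_smul]⟩

end BitMasks

section GeneratorMatrices

variable {n k d : ℕ} {rs : List (ℕ × ℕ)}

/-- The combination of the vectors coded by `rs` with the given coefficients. -/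
noncomputable def encode (n : ℕ) (rs : List (ℕ × ℕ)) : (Fin rs.length → F4) →ₗ[F4] (Fin n → F4) :=
  Fintype.linearCombination F4 fun i => decode n rs[i]

/-- The rows `rs` form a systematic generator matrix of dimension `k`, with the unit matrix in the
first `k` columns. -/
abbrev IsSystematic (k : ℕ) (rs : List (ℕ × ℕ)) : Prop :=
  rs.length = k ∧ ∀ i : Fin rs.length, rs[i].1 % 2 ^ k = 2 ^ (i : ℕ) ∧ rs[i].2 % 2 ^ k = 0

/-- Whether all combinations of the rows with fewer than `d` nonzero coefficients, added to `p`,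
have weight at least `d`. Here `j` coefficients have been used already, and the combination without
any nonzero coefficient is ignored. -/
def scan (n d : ℕ) : List (ℕ × ℕ) → ℕ → ℕ × ℕ → Bool
  | [], j, p => j == 0 || d.ble (maskWeight n p)
  | r :: rs, j, p => d.ble j ||
      (scan n d rs j p && (multiples r).all fun q => scan n d rs (j + 1) (addMasks p q))

lemma encode_apply (g : Fin rs.length → F4) : encode n rs g = ∑ i, g i • decode n rs[i] :=
  Fintype.linearCombination_apply ..

lemma encode_cons (r : ℕ × ℕ) (g : Fin (r :: rs).length → F4) :
    encode n (r :: rs) g = g 0 • decode n r + encode n rs (fun i => g i.succ) := by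
  rw [encode_apply, encode_apply]
  exact Fin.sum_univ_succ (n := rs.length) (fun i => g i • decode n (r :: rs)[i])

lemma decode_mem_range_encode {r : ℕ × ℕ} (hr : r ∈ rs) :
    decode n r ∈ LinearMap.range (encode n rs) := by
  rw [encode, Fintype.range_linearCombination]
  obtain ⟨i, hi, rfl⟩ := List.mem_iff_getElem.1 hr
  exact Submodule.subset_span ⟨⟨i, hi⟩, rfl⟩

lemma hammingNorm_succ {m : ℕ} (g : Fin (m + 1) → F4) :
    hammingNorm g = (if g 0 = 0 then 0 else 1) + hammingNorm (fun i : Fin m => g i.succ) := by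
  simp only [hammingNorm, Finset.card_filter, Fin.sum_univ_succ, ne_eq, ite_not]

lemma le_hammingNorm_of_scan {j : ℕ} {p : ℕ × ℕ} (h : scan n d rs j p = true)
    (g : Fin rs.length → F4) :
    j + hammingNorm g = 0 ∨ d ≤ j + hammingNorm g ∨
      d ≤ hammingNorm (decode n p + encode n rs g) := by
  induction rs generalizing j p with
  | nil =>
    have hg : hammingNorm g = 0 := hammingNorm_eq_zero.2 (funext fun i => Fin.elim0 i)
    have he : encode n [] g = 0 := by rw [encode_apply]; rfl
    simp only [scan, Bool.or_eq_true, beq_iff_eq, Nat.ble_eq, ← hammingNorm_decode] at h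
    rw [hg, he, add_zero, add_zero]
    exact h.imp_right .inr
  | cons r rs ih =>
    simp only [scan, Bool.or_eq_true, Bool.and_eq_true, List.all_eq_true, Nat.ble_eq] at h
    have hnorm : hammingNorm g =
        (if g 0 = 0 then 0 else 1) + hammingNorm fun i : Fin rs.length => g i.succ :=
      hammingNorm_succ g
    rcases h with h | ⟨hskip, huse⟩
    · exact .inr (.inl (h.trans (Nat.le_add_right _ _)))
    rw [hnorm, encode_cons]
    by_cases hg : g 0 = 0
    · rw [if_pos hg, zero_add, hg, zero_smul, zero_add]
      exact ih hskip _
    · obtain ⟨q, hq, hdecode⟩ := exists_mem_multiples (n := n) hg r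
      rw [if_neg hg, ← add_assoc, ← add_assoc, ← hdecode, ← decode_addMasks]
      exact ih (huse q hq) _

lemma IsSystematic.encode_apply_castLE (hsys : IsSystematic k rs) (hk : k ≤ n)
    (g : Fin rs.length → F4) (j : Fin rs.length) :
    encode n rs g (Fin.castLE (hsys.1.trans_le hk) j) = g j := by
  have hdecode : ∀ i : Fin rs.length,
      decode n rs[i] (Fin.castLE (hsys.1.trans_le hk) j) = if i = j then 1 else 0 := by
    intro i
    have hj : (j : ℕ) < k := hsys.1 ▸ j.2
    have h₁ := congrArg (Nat.testBit · j) (hsys.2 i).1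
    have h₂ := congrArg (Nat.testBit · j) (hsys.2 i).2
    simp only [Nat.testBit_mod_two_pow, hj, decide_true, Bool.true_and, Nat.testBit_two_pow,
      Nat.zero_testBit, Fin.val_inj] at h₁ h₂
    simp only [decode, Fin.val_castLE, h₁, h₂, bit, decide_eq_true_eq, Bool.false_eq_true,
      if_false, zero_mul, add_zero]
  simp only [encode_apply, Finset.sum_apply, Pi.smul_apply, hdecode, smul_eq_mul, mul_ite,
    mul_one, mul_zero, Finset.sum_ite_eq', Finset.mem_univ, if_true]

lemma IsSystematic.hammingNorm_le_hammingNorm_encode (hsys : IsSystematic k rs) (hk : k ≤ n)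
    (g : Fin rs.length → F4) : hammingNorm g ≤ hammingNorm (encode n rs g) := by
  refine Finset.card_le_card_of_injOn (Fin.castLE (hsys.1.trans_le hk)) (fun j hj => ?_)
    (Fin.castLE_injective _).injOn
  simp only [Finset.coe_filter, Finset.mem_univ, true_and, Set.mem_ofPred_eq] at hj ⊢
  rwa [hsys.encode_apply_castLE hk]

lemma IsSystematic.finrank_range_encode (hsys : IsSystematic k rs) (hk : k ≤ n) :
    Module.finrank F4 (LinearMap.range (encode n rs)) = k := by
  rw [LinearMap.finrank_range_of_inj fun g g' hg => ?_, Module.finrank_fin_fun, hsys.1]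
  funext j
  rw [← hsys.encode_apply_castLE hk g, ← hsys.encode_apply_castLE hk g', hg]

lemma IsSystematic.minDistGE_of_scan (hsys : IsSystematic k rs) (hk : k ≤ n)
    (h : scan n d rs 0 (0, 0) = true) : MinDistGE (LinearMap.range (encode n rs)) d := by
  rintro _ ⟨g, rfl⟩ h0
  have hg : hammingNorm g ≠ 0 := hammingNorm_ne_zero_iff.2 fun hg => h0 (by rw [hg, map_zero])
  have hor := le_hammingNorm_of_scan h g
  rw [decode_zero, zero_add, zero_add] at hor
  rcases hor with hzero | hle | hle
  · exact absurd hzero hg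
  · exact hle.trans (hsys.hammingNorm_le_hammingNorm_encode hk g)
  · exact hle

end GeneratorMatrices

section GramSchmidt

variable {n m : ℕ} {C : Submodule F4 (Fin n → F4)} {p q r : ℕ × ℕ} {rs fs : List (ℕ × ℕ)}

/-- Orthogonality of vectors coded by bit masks, expressed by the parity of weights. -/
def Orthogonal (n : ℕ) (p q : ℕ × ℕ) : Prop :=
  Even (maskWeight n p + maskWeight n q + maskWeight n (addMasks p q)) ∧
    Even (maskWeight n p + maskWeight n q + maskWeight n (addMasks (omegaMasks p) q))

instance : DecidableRel (Orthogonal n) := fun _ _ => inferInstanceAs (Decidable (_ ∧ _))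

lemma Orthogonal.hermInner_eq_zero (h : Orthogonal n p q) :
    hermInner (decode n p) (decode n q) = 0 := by
  simp only [Orthogonal, ← hammingNorm_decode, decode_addMasks, decode_omegaMasks] at h
  exact hermInner_eq_zero_of_even h.1 h.2

/-- The affine line of the vectors `r + a p` with a scalar `a`, in the coding by bit masks. -/
def line (r p : ℕ × ℕ) : List (ℕ × ℕ) := r :: (multiples p).map (addMasks r)

/-- The projection of `r` to the orthogonal complement of a vector `f` of odd weight. -/
def project (n : ℕ) (f r : ℕ × ℕ) : ℕ × ℕ :=
  ((line r f).find? (Orthogonal n f)).getD r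

/-- Gram–Schmidt orthogonalization: `m` times, a vector of odd weight on some line through two of
the vectors `rs` is moved to `fs` and `rs` is projected to its orthogonal complement. In the end, a
nonzero vector among the projections is added to `fs`. -/
def orthogonalize (n : ℕ) : ℕ → List (ℕ × ℕ) → List (ℕ × ℕ) → List (ℕ × ℕ)
  | 0, rs, fs => (rs.find? fun r => maskWeight n r ≠ 0).getD (0, 0) :: fs
  | m + 1, rs, fs =>
    let f := ((rs.flatMap fun r => rs.flatMap (line r)).find? fun r => Odd (maskWeight n r)).getD
      (0, 0)
    orthogonalize n m (rs.map (project n f)) (f :: fs)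

lemma decode_mem_of_mem_line (hr : decode n r ∈ C) (hp : decode n p ∈ C) (hq : q ∈ line r p) :
    decode n q ∈ C := by
  rw [line, List.mem_cons, List.mem_map] at hq
  rcases hq with rfl | ⟨p', hp', rfl⟩
  · exact hr
  · obtain ⟨a, ha⟩ := exists_smul_of_mem_multiples (n := n) hp'
    rw [decode_addMasks, ha]
    exact C.add_mem hr (C.smul_mem a hp)

lemma decode_getD_find?_mem {l : List (ℕ × ℕ)} (hl : ∀ p ∈ l, decode n p ∈ C)
    (hq : decode n q ∈ C) (P : ℕ × ℕ → Bool) : decode n ((l.find? P).getD q) ∈ C := by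
  cases h : l.find? P with
  | none => exact hq
  | some p => exact hl p (List.mem_of_find?_eq_some h)

lemma decode_mem_of_mem_orthogonalize (hrs : ∀ r ∈ rs, decode n r ∈ C)
    (hfs : ∀ f ∈ fs, decode n f ∈ C) : ∀ p ∈ orthogonalize n m rs fs, decode n p ∈ C := by
  have hzero : decode n (0, 0) ∈ C := decode_zero (n := n) ▸ C.zero_mem
  induction m generalizing rs fs with
  | zero => exact List.forall_mem_cons.2 ⟨decode_getD_find?_mem hrs hzero _, hfs⟩
  | succ _ ih =>
    have hf := fun P => decode_getD_find?_mem (n := n) (C := C)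
      (l := rs.flatMap fun r => rs.flatMap (line r)) (by
        simp only [List.mem_flatMap]
        rintro p ⟨r, hr, r', hr', hp⟩
        exact decode_mem_of_mem_line (hrs r hr) (hrs r' hr') hp) hzero P
    refine ih (List.forall_mem_map.2 fun r hr => ?_) (List.forall_mem_cons.2 ⟨hf _, hfs⟩)
    exact decode_getD_find?_mem (fun p hp => decode_mem_of_mem_line (hrs r hr) (hf _) hp)
      (hrs r hr) _

/-- An orthogonal basis in which only the first vector is isotropic, in the coding by bit masks. -/
def IsHullBasis (n : ℕ) : List (ℕ × ℕ) → Prop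
  | [] => False
  | h :: fs => maskWeight n h ≠ 0 ∧ Even (maskWeight n h) ∧ (∀ f ∈ fs, Odd (maskWeight n f)) ∧
      (h :: fs).Pairwise (Orthogonal n)

instance : DecidablePred (IsHullBasis n)
  | [] => inferInstanceAs (Decidable False)
  | _ :: _ => inferInstanceAs (Decidable (_ ∧ _))

lemma finrank_hermHull_eq_one_of_isHullBasis {gs : List (ℕ × ℕ)} (hgs : IsHullBasis n gs)
    (hC : ∀ p ∈ gs, decode n p ∈ C) (hcard : Module.finrank F4 C = gs.length) :
    Module.finrank F4 (hermHull C) = 1 := by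
  match gs, hgs with
  | h :: fs, ⟨h0, hiso, hnon, horth⟩ =>
  have hself : ∀ p, hermInner (decode n p) (decode n p) = 0 ↔ Even (maskWeight n p) := fun p => by
    rw [hermInner_self, natCast_F4_eq_zero_iff, hammingNorm_decode]
  have hlt : ∀ i j : Fin (fs.length + 1), i < j →
      hermInner (decode n (h :: fs)[i]) (decode n (h :: fs)[j]) = 0 := fun i j hij =>
    (List.pairwise_iff_getElem.1 horth i j i.2 j.2 hij).hermInner_eq_zero
  refine finrank_hermHull_eq_one (e := fun i : Fin (fs.length + 1) => decode n (h :: fs)[i])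
    (i₀ := 0) (fun i => hC _ (List.getElem_mem _)) (by rw [hcard, Fintype.card_fin]; rfl)
    (fun i j hij => ?_) ?_ ((hself h).2 hiso) fun i hi => ?_
  · rcases hij.lt_or_gt with hij | hji
    · exact hlt i j hij
    · exact hermInner_comm_eq_zero (hlt j i hji)
  · rwa [← hammingNorm_ne_zero_iff, hammingNorm_decode]
  · obtain ⟨j, rfl⟩ := Fin.exists_succ_eq.2 hi
    exact (hself _).not.2 (Nat.not_even_iff_odd.2 (hnon _ (List.getElem_mem _)))

lemma length_orthogonalize (m : ℕ) (rs fs : List (ℕ × ℕ)) :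
    (orthogonalize n m rs fs).length = fs.length + m + 1 := by
  induction m generalizing rs fs with
  | zero => rfl
  | succ _ ih => rw [orthogonalize, ih, List.length_cons]; omega

lemma IsSystematic.finrank_hermHull_eq_one {k : ℕ} (hsys : IsSystematic k rs) (hk : 1 ≤ k)
    (hkn : k ≤ n) (hbasis : IsHullBasis n (orthogonalize n (k - 1) rs [])) :
    Module.finrank F4 (hermHull (LinearMap.range (encode n rs))) = 1 := by
  refine finrank_hermHull_eq_one_of_isHullBasis hbasis
    (decode_mem_of_mem_orthogonalize (fun _ => decode_mem_range_encode) (by simp)) ?_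
  rw [hsys.finrank_range_encode hkn, length_orthogonalize, List.length_nil]
  omega

end GramSchmidt

section Codes

/-- The redundant parts of systematic generator matrices: row `n` lists, for `k = 1, …, n - 1`, the
rows of the `k × (n - k)` block beside the unit matrix. The lowest hexadecimal digit is the first
coordinate of the block, and the digits `0, 1, 2, 3` stand for `0, 1, ω, ω ^ 2`. -/
def redundancy : ℕ → List (List ℕ)
  | 2 => [
      [0x3]]
  | 3 => [
      [0x02],
      [0x2, 0x0]]
  | 4 => [
      [0x312],
      [0x11, 0x21],
      [0x3, 0x3, 0x1]]
  | 5 => [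
      [0x3103],
      [0x223, 0x102],
      [0x23, 0x31, 0x01],
      [0x2, 0x1, 0x3, 0x0]]
  | 6 => [
      [0x21123],
      [0x1021, 0x1333],
      [0x223, 0x211, 0x230],
      [0x10, 0x22, 0x13, 0x30],
      [0x2, 0x3, 0x3, 0x2, 0x2]]
  | 7 => [
      [0x202313],
      [0x22102, 0x10223],
      [0x3210, 0x1102, 0x0131],
      [0x230, 0x130, 0x333, 0x220],
      [0x13, 0x21, 0x20, 0x20, 0x03],
      [0x1, 0x3, 0x0, 0x2, 0x1, 0x3]]
  | 8 => [
      [0x2121323],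
      [0x303212, 0x233323],
      [0x32303, 0x30122, 0x32232],
      [0x3320, 0x1123, 0x2302, 0x3132],
      [0x132, 0x033, 0x032, 0x332, 0x331],
      [0x22, 0x10, 0x33, 0x22, 0x21, 0x23],
      [0x2, 0x2, 0x3, 0x1, 0x1, 0x1, 0x1]]
  | 9 => [
      [0x23230332],
      [0x1231122, 0x3213202],
      [0x132312, 0x121110, 0x211302],
      [0x21231, 0x11011, 0x23132, 0x32230],
      [0x1021, 0x1332, 0x3031, 0x3110, 0x2210],
      [0x222, 0x102, 0x012, 0x210, 0x103, 0x202],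
      [0x11, 0x03, 0x20, 0x31, 0x22, 0x10, 0x10],
      [0x0, 0x3, 0x0, 0x0, 0x0, 0x3, 0x2, 0x0]]
  | 10 => [
      [0x122213133],
      [0x01302211, 0x20233220],
      [0x1021313, 0x2012213, 0x2322311],
      [0x021130, 0x331010, 0x111312, 0x002331],
      [0x01112, 0x31033, 0x22303, 0x23113, 0x20132],
      [0x3012, 0x1333, 0x3213, 0x1201, 0x1130, 0x1220],
      [0x102, 0x212, 0x031, 0x321, 0x223, 0x312, 0x233],
      [0x23, 0x23, 0x21, 0x31, 0x32, 0x13, 0x10, 0x11],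
      [0x2, 0x2, 0x3, 0x2, 0x2, 0x1, 0x1, 0x3, 0x1]]
  | 11 => [
      [0x3313301113],
      [0x310113330, 0x111102211],
      [0x13301023, 0x22211203, 0x12032333],
      [0x1332033, 0x3322303, 0x0011113, 0x1203320],
      [0x112023, 0x223202, 0x021232, 0x202323, 0x001113],
      [0x10302, 0x22012, 0x31122, 0x21013, 0x02303, 0x31300],
      [0x2033, 0x0232, 0x1202, 0x2210, 0x1221, 0x3023, 0x0133],
      [0x302, 0x032, 0x322, 0x233, 0x120, 0x132, 0x222, 0x130],
      [0x02, 0x32, 0x20, 0x32, 0x21, 0x13, 0x20, 0x21, 0x20],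
      [0x0, 0x1, 0x1, 0x1, 0x0, 0x0, 0x0, 0x3, 0x1, 0x0]]
  | 12 => [
      [0x11213232323],
      [0x3133122313, 0x3323033130],
      [0x322223321, 0x200213222, 0x132123033],
      [0x21113203, 0x03022213, 0x10223110, 0x13013220],
      [0x3300133, 0x2311013, 0x2130023, 0x0021113, 0x0311320],
      [0x213302, 0x330212, 0x032113, 0x302132, 0x333331, 0x211033],
      [0x21013, 0x23201, 0x22213, 0x23232, 0x30210, 0x10313, 0x23131],
      [0x3201, 0x2022, 0x1320, 0x3113, 0x3303, 0x0323, 0x3021, 0x2111],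
      [0x321, 0x201, 0x130, 0x232, 0x303, 0x113, 0x123, 0x022, 0x133],
      [0x32, 0x30, 0x01, 0x31, 0x20, 0x01, 0x33, 0x32, 0x12, 0x12],
      [0x3, 0x3, 0x1, 0x1, 0x3, 0x2, 0x1, 0x2, 0x2, 0x3, 0x3]]
  | _ => []

/-- The redundant parts, coded as in `redundancy`, of systematic generator matrices whose codes
have a larger minimum distance than any code of the same length and dimension with a
one-dimensional Hermitian hull. -/
def betterRedundancy : ℕ → ℕ → List ℕ
  | 10, 4 => [0x223303, 0x121332, 0x332230, 0x133031]
  | 11, 5 => [0x331231, 0x322203, 0x103233, 0x022111, 0x323332]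
  | 11, 6 => [0x13313, 0x22331, 0x10122, 0x22013, 0x23222, 0x21302]
  | _, _ => []

/-- The pair of bit masks of the vector of length `n` coded by the hexadecimal digits of `x`. -/
def masks : ℕ → ℕ → ℕ × ℕ
  | 0, _ => (0, 0)
  | n + 1, x =>
    (x % 2 + 2 * (masks n (x / 16)).1, x / 2 % 2 + 2 * (masks n (x / 16)).2)

/-- The rows of the systematic generator matrix with the given redundant part, in the coding by
bit masks. -/
def systematicRows (n k : ℕ) (A : List ℕ) : List (ℕ × ℕ) :=
  A.zipIdx.map fun x => masks n (16 ^ x.2 + 16 ^ k * x.1)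

/-- The rows of a generator matrix that attains the table entry. -/
def generators (n k : ℕ) : List (ℕ × ℕ) :=
  systematicRows n k ((redundancy n).getD (k - 1) [])

lemma isSystematic_generators :
    ∀ n ∈ Finset.range 13, ∀ k ∈ Finset.Ico 1 n, IsSystematic k (generators n k) := by
  decide +kernel

lemma isHullBasis_orthogonalize_generators : ∀ n ∈ Finset.range 13, ∀ k ∈ Finset.Ico 1 n,
    IsHullBasis n (orthogonalize n (k - 1) (generators n k) []) := by
  decide +kernel

lemma scan_generators : ∀ n ∈ Finset.range 13, ∀ k ∈ Finset.Ico 1 n,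
    scan n (tableEntry n k) (generators n k) 0 (0, 0) = true := by
  decide +kernel

lemma isSystematic_and_scan_better : ∀ p ∈ [(10, 4), (11, 5), (11, 6)],
    IsSystematic p.2 (systematicRows p.1 p.2 (betterRedundancy p.1 p.2)) ∧
      scan p.1 (tableEntry p.1 p.2 + 1) (systematicRows p.1 p.2 (betterRedundancy p.1 p.2)) 0
        (0, 0) = true := by
  decide +kernel

lemma isD4H_tableEntry {n k : ℕ} (hk : 1 ≤ k) (hkn : k < n) (hn : n ≤ 12) :
    IsD4H n k 1 (tableEntry n k) := by
  have hlight : ∀ C : Submodule F4 (Fin n → F4), Module.finrank F4 C = k →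
      Module.finrank F4 (hermHull C) = 1 → ∃ c ∈ C, c ≠ 0 ∧ hammingNorm c ≤ tableEntry n k := by
    intro C hdim hl
    have hC := not_minDistGE_tableEntry_add_one hk hkn hn hdim hl
    simp only [MinDistGE, not_forall, not_le, Nat.lt_succ_iff] at hC
    obtain ⟨c, hc, h0, hle⟩ := hC
    exact ⟨c, hc, h0, hle⟩
  have hn' : n ∈ Finset.range 13 := Finset.mem_range.2 (by omega)
  have hk' : k ∈ Finset.Ico 1 n := Finset.mem_Ico.2 ⟨hk, hkn⟩
  have hsys := isSystematic_generators n hn' k hk'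
  have hd := hsys.minDistGE_of_scan hkn.le (scan_generators n hn' k hk')
  have hdim := hsys.finrank_range_encode hkn.le
  have hl := hsys.finrank_hermHull_eq_one hk hkn.le
    (isHullBasis_orthogonalize_generators n hn' k hk')
  refine ⟨⟨_, ⟨hdim, ?_, ?_⟩, hl⟩, ?_⟩
  · obtain ⟨c, hc, h0, hle⟩ := hlight _ hdim hl
    exact ⟨c, hc, h0, hle.antisymm (hd c hc h0)⟩
  · rintro _ ⟨c, hc, h0, rfl⟩
    exact hd c hc h0
  · rintro d ⟨C, ⟨hdim, -, hleast⟩, hl⟩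
    obtain ⟨c, hc, h0, hle⟩ := hlight C hdim hl
    exact (hleast ⟨c, hc, h0, rfl⟩).trans hle

lemma exists_isD4 {n k d : ℕ} {C : Submodule F4 (Fin n → F4)} (hk : 1 ≤ k)
    (hdim : Module.finrank F4 C = k) (hd : MinDistGE C d) : ∃ D, IsD4 n k D ∧ d ≤ D := by
  obtain ⟨c₀, hc₀, h0⟩ := C.exists_mem_ne_zero_of_ne_bot fun hbot => by
    rw [hbot, finrank_bot] at hdim
    omega
  have hmin : IsLeast {w | ∃ c ∈ C, c ≠ 0 ∧ hammingNorm c = w} _ :=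
    isLeast_csInf ⟨_, c₀, hc₀, h0, rfl⟩
  have hbdd : BddAbove {d | ∃ C : Submodule F4 (Fin n → F4), IsCode n k d C} := by
    refine ⟨n, ?_⟩
    rintro _ ⟨_, -, ⟨c, -, -, rfl⟩, -⟩
    exact hammingNorm_le_card_fintype.trans_eq (Fintype.card_fin n)
  obtain ⟨D, hD⟩ := hbdd.exists_isGreatest_of_nonempty ⟨_, C, hdim, hmin⟩
  obtain ⟨c, hc, hcne, hw⟩ := hmin.1
  exact ⟨D, hD, (hd c hc hcne).trans (hw.trans_le (hD.2 ⟨C, hdim, hmin⟩))⟩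

end Codes

end Quaternary

theorem mainTheorem6 :
    (∀ n k : ℕ, 1 ≤ k → k < n → n ≤ 12 →
      Quaternary.IsD4H n k 1 (Quaternary.tableEntry n k)) ∧
    (∀ n k : ℕ, (n, k) ∈ ({(10, 4), (11, 5), (11, 6)} : Set (ℕ × ℕ)) →
      ∃ a b : ℕ, Quaternary.IsD4H n k 1 a ∧ Quaternary.IsD4 n k b ∧ a < b) := by
  refine ⟨fun n k hk hkn hn => Quaternary.isD4H_tableEntry hk hkn hn, fun n k hnk => ?_⟩
  have hbound : 1 ≤ k ∧ k < n ∧ n ≤ 12 := by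
    simp only [Set.mem_insert_iff, Set.mem_singleton_iff, Prod.mk.injEq] at hnk
    omega
  obtain ⟨hsys, hscan⟩ := Quaternary.isSystematic_and_scan_better (n, k) (by simpa using hnk)
  have hdim := hsys.finrank_range_encode hbound.2.1.le
  have hd := hsys.minDistGE_of_scan hbound.2.1.le hscan
  obtain ⟨D, hD, hlt⟩ := Quaternary.exists_isD4 hbound.1 hdim hd
  exact ⟨_, D, Quaternary.isD4H_tableEntry hbound.1 hbound.2.1 hbound.2.2, hD, hlt⟩
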